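/- **Messages.** Messages are generated by variables, constants $\mathtt g$ and $\mathtt{auth}$, multiplication $M\cdot N$, scalar multiplication $\phi(M,N)$, pairs $\langle M,N\rangle$, hash $h(M)$, public key $\mathrm{pk}(K)$, signature $\mathrm{sig}(K,M)$ (key $K$), encryption $\{M\}_K$, decryption $\mathrm{dec}(K,M)$, signature check $\mathrm{check}(V,M)$, and projections $\mathrm{fst},\mathrm{snd}$. The theory $E_0$ is the congruence generated by $M\cdot N=N\cdot M$, $(M\cdot N)\cdot K=M\cdot(N\cdot K)$, $\phi(M\cdot N,K)=\phi(M,\phi(N,K))$, $\mathrm{fst}\langle M,N\rangle=M$, $\mathrm{snd}\langle M,N\rangle=N$, $\mathrm{dec}(K,\{M\}_K)=M$, $\mathrm{check}(\mathrm{pk}(K),\mathrm{sig}(K,M))=M$; $E$ adds $\phi(M,\mathrm{sig}(K,N))=\mathrm{sig}(K,\phi(M,N))$. In the approximated theories $\tilde E_0,\tilde E$ the first three equations are replaced by $\phi(A,\phi(B,\mathtt g))=\phi(B,\phi(A,\mathtt g))$ and $\phi(A,\phi(B,\phi(C,\mathtt g)))=\phi(B,\phi(A,\phi(C,\mathtt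 g)))$; the projection and decryption equations are kept; for signatures, $\tilde E_0$ has $\mathrm{check}(\mathrm{pk}(K),\mathrm{sig}(K,M))=M$ and $\tilde E$ has instead $\mathrm{check}(\mathrm{pk}(K),\phi(M,\mathrm{sig}(K,N)))=\phi(M,N)$. **Processes.** Processes of the applied $\pi$-calculus are built from $0$, output $\overline{M}\langle N\rangle.P$, input $M(y).P$, restriction $\nu x.P$, parallel composition $P\mid Q$, replication $!P$ and match $[M=N]P$, up to $\alpha$-conversion. A state is $\nu\vec x.(\sigma\mid P)$, where the frame $\sigma$ is a substitution recording the messages sent so far. Modulo a theory: $\sigma\mid K(y).P$ has the input transition $M\,N$ to $\sigma\mid P\{N\sigma/y\}$ if $M\sigma=K$; $\sigma\mid\overline K\langle N\rangle.P$ has the output transition $\overline M(u)$, $u$ fresh, to $\{N/u\}\circ\sigma\mid P$ if $M\sigma=K$; a match $[M=N]P$ moves like $P$ if $M=N$; private names never occur in labels, and parallel composition, restriction and replication are treated as usual. There is no internal communication. A state $\nu\vec x.(\sigma\mid P)$ satisfies $M=N$, where $M,N$ contain no name in $\vec x$, if $M\sigma=N\sigma$ modulo the theory. **Protocols.** The original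 (BDH) card and terminal are $$C(s,c,ch)=\nu a.\ \overline{ch}\langle\phi(a,\phi(c,\mathtt g))\rangle.\ ch(y).\ \overline{ch}\langle\{\langle\langle a,\phi(c,\mathtt g)\rangle,\langle\phi(c,\mathtt g),\mathrm{sig}(s,\phi(c,\mathtt g))\rangle\rangle\}_{k_c}\rangle,\qquad k_c=h(\phi(a\cdot c,y)),$$ $$T(s,ch)=\nu t.\ ch(z_1).\ \overline{ch}\langle\phi(t,\mathtt g)\rangle.\ ch(z_2).\ [\mathrm{snd}\,m_1=\mathrm{check}(\mathrm{pk}(s),\mathrm{snd}\,m_2)]\,[\phi(\mathrm{fst}\,m_1,\mathrm{snd}\,m_1)=z_1]\ \overline{ch}\langle\mathtt{auth}\rangle,$$ with $m_1=\mathrm{fst}(\mathrm{dec}(k_t,z_2))$, $m_2=\mathrm{snd}(\mathrm{dec}(k_t,z_2))$, $k_t=h(\phi(t,z_1))$. In the fixed protocol (FIX) the plaintext of the card's last message is instead $\langle\phi(a,\phi(c,\mathtt g)),\phi(a,\mathrm{sig}(s,\phi(c,\mathtt g)))\rangle$, and the terminal's two tests are $m_1=\mathrm{check}(\mathrm{pk}(s),m_2)$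 and $m_1=z_1$. For each protocol, $$\mathit{SYS}=\nu s.\big(!\nu c.!\nu ch_c.\overline{card}\langle ch_c\rangle.C(s,c,ch_c)\ \mid\ \overline{out}\langle\mathrm{pk}(s)\rangle.!\nu ch_t.\overline{term}\langle ch_t\rangle.T(s,ch_t)\big),$$ where $out$, $card$, $term$ are distinct free names. $\widetilde{\mathit{SYS}}$ is the same with $k_c=h(\phi(a,\phi(c,y)))$. **Injective agreement.** $\mathit{SYS}$ satisfies injective agreement modulo a theory if for every execution $\mathit{SYS}\xrightarrow{\pi_0}\cdots\xrightarrow{\pi_n}B$ there is an injective $f:\mathbb N\to\mathbb N$ such that for every $0<a\le n$ for which $\pi_a=\overline{ch_t}(w)$ and $B$ satisfies $w=\mathtt{auth}$: (1) for some $0\le i<j<k<a$, $\pi_i=ch_t\,M_i$, $\pi_j=\overline{ch_t}(u_j)$, $\pi_k=ch_t\,M_k$; (2) $\pi_{f(a)}=\overline{card}(ch_c)$ and for some $f(a)<i'<j'<k'<a$, $\pi_{i'}=\overline{ch_c}(u_i)$, $\pi_{j'}=ch_c\,M_j$, $\pi_{k'}=\overline{ch_c}(u_k)$; (3) $B$ satisfies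 $u_\ell=M_\ell$ for $\ell\in\{i,j,k\}$. Here the channels of labels are identified whenever $B$ satisfies their equality. **Theorem.** $\mathit{SYS}_{\mathrm{BDH}}$ modulo $E_0$ and $\mathit{SYS}_{\mathrm{FIX}}$ modulo $E$ satisfy injective agreement. Likewise, under the approximated Diffie-Hellman theories, $\widetilde{\mathit{SYS}}_{\mathrm{BDH}}$ modulo $\tilde E_0$ and $\widetilde{\mathit{SYS}}_{\mathrm{FIX}}$ modulo $\tilde E$ satisfy injective agreement. -/

import Mathlib

namespace EMV

/-! ## Messages

Variables are natural numbers and binders are handled by de Bruijn indices: underneath a binder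
the bound variable is `0` and a variable `x` of the enclosing scope is `x + 1`. Hence processes are
literally identified up to renaming of bound variables, and there are infinitely many free
variables at top level. -/

inductive Term : Type
  | var (x : ℕ)
  | g
  | mult (M N : Term)
  /-- `smult M N` is the scalar multiplication of the point `N` by the scalar `M`. -/
  | smult (M N : Term)
  | pair (M N : Term)
  | hash (M : Term)
  /-- `pks K` is the public key of the signing key `K`. -/
  | pks (K : Term)
  /-- `sig K M` is the signature on `M` with the signing key `K`. -/
  | sig (K M : Term)
  /-- `enc M K` is the symmetric encryption of `M` with the key `K`. -/
  | enc (M K : Term)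
  /-- `dec K M` is the symmetric decryption of `M` with the key `K`. -/
  | dec (K M : Term)
  /-- `checksig V M` is the check of the signature `M` against the public key `V`. -/
  | checksig (V M : Term)
  | fst (M : Term)
  | snd (M : Term)
  | auth

/-- A substitution. It is the identity outside of its domain `{x | σ x ≠ var x}`. -/
abbrev Subst : Type := ℕ → Term

namespace Term

def subst (σ : Subst) : Term → Term
  | var x => σ x
  | g => g
  | mult M N => mult (M.subst σ) (N.subst σ)
  | smult M N => smult (M.subst σ) (N.subst σ)
  | pair M N => pair (M.subst σ) (N.subst σ)
  | hash M => hash (M.subst σ)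
  | pks K => pks (K.subst σ)
  | sig K M => sig (K.subst σ) (M.subst σ)
  | enc M K => enc (M.subst σ) (K.subst σ)
  | dec K M => dec (K.subst σ) (M.subst σ)
  | checksig V M => checksig (V.subst σ) (M.subst σ)
  | fst M => fst (M.subst σ)
  | snd M => snd (M.subst σ)
  | auth => auth

/-- The same term, seen from underneath one more binder. -/
def up (M : Term) : Term := M.subst fun x => var (x + 1)

/-- The variable `u` does not occur in the term. -/
def Fresh (u : ℕ) : Term → Prop
  | var x => u ≠ x
  | g => True
  | mult M N => M.Fresh u ∧ N.Fresh u
  | smult M N => M.Fresh u ∧ N.Fresh u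
  | pair M N => M.Fresh u ∧ N.Fresh u
  | hash M => M.Fresh u
  | pks K => K.Fresh u
  | sig K M => K.Fresh u ∧ M.Fresh u
  | enc M K => M.Fresh u ∧ K.Fresh u
  | dec K M => K.Fresh u ∧ M.Fresh u
  | checksig V M => V.Fresh u ∧ M.Fresh u
  | fst M => M.Fresh u
  | snd M => M.Fresh u
  | auth => True

end Term

namespace Subst

/-- The empty substitution. -/
def id : Subst := Term.var

/-- The same substitution, seen from underneath one more binder. -/
def lift (σ : Subst) : Subst
  | 0 => Term.var 0
  | x + 1 => (σ x).up

/-- The substitution that replaces the outermost bound variable by `N`. -/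
def inst (N : Term) : Subst
  | 0 => N
  | x + 1 => Term.var x

/-- `u` is neither in the domain nor in the range of `σ`. -/
def Fresh (u : ℕ) (σ : Subst) : Prop :=
  σ u = Term.var u ∧ ∀ x, x ≠ u → (σ x).Fresh u

end Subst

/-! ## Equational theories -/

/-- A set of axioms (all instances of the axiom schemes). -/
abbrev Axioms : Type := Term → Term → Prop

/-- Equality of messages modulo the axioms: the least congruence that contains them. -/
inductive EqE (Ax : Axioms) : Term → Term → Prop
  | ax {M N} : Ax M N → EqE Ax M N
  | refl (M) : EqE Ax M M
  | symm {M N} : EqE Ax M N → EqE Ax N M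
  | trans {M N K} : EqE Ax M N → EqE Ax N K → EqE Ax M K
  | mult {M M' N N'} : EqE Ax M M' → EqE Ax N N' → EqE Ax (.mult M N) (.mult M' N')
  | smult {M M' N N'} : EqE Ax M M' → EqE Ax N N' → EqE Ax (.smult M N) (.smult M' N')
  | pair {M M' N N'} : EqE Ax M M' → EqE Ax N N' → EqE Ax (.pair M N) (.pair M' N')
  | hash {M M'} : EqE Ax M M' → EqE Ax (.hash M) (.hash M')
  | pks {M M'} : EqE Ax M M' → EqE Ax (.pks M) (.pks M')
  | sig {M M' N N'} : EqE Ax M M' → EqE Ax N N' → EqE Ax (.sig M N) (.sig M' N')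
  | enc {M M' N N'} : EqE Ax M M' → EqE Ax N N' → EqE Ax (.enc M N) (.enc M' N')
  | dec {M M' N N'} : EqE Ax M M' → EqE Ax N N' → EqE Ax (.dec M N) (.dec M' N')
  | checksig {M M' N N'} :
      EqE Ax M M' → EqE Ax N N' → EqE Ax (.checksig M N) (.checksig M' N')
  | fst {M M'} : EqE Ax M M' → EqE Ax (.fst M) (.fst M')
  | snd {M M'} : EqE Ax M M' → EqE Ax (.snd M) (.snd M')

open Term in
/-- Multiplication of scalars, and scalar multiplication as an action. -/
inductive ScalarAx : Axioms
  | comm (M N) : ScalarAx (mult M N) (mult N M)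
  | assoc (M N K) : ScalarAx (mult (mult M N) K) (mult M (mult N K))
  | act (M N K) : ScalarAx (smult (mult M N) K) (smult M (smult N K))

open Term in
/-- The approximation of the scalar axioms by two Diffie-Hellman equations. -/
inductive DHAx : Axioms
  | swap (A B) : DHAx (smult A (smult B g)) (smult B (smult A g))
  | swapBlinded (A B C) :
      DHAx (smult A (smult B (smult C g))) (smult B (smult A (smult C g)))

open Term in
/-- Projections and decryption. -/
inductive DestructorAx : Axioms
  | fst (M N) : DestructorAx (fst (pair M N)) M
  | snd (M N) : DestructorAx (snd (pair M N)) N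
  | dec (M K) : DestructorAx (dec K (enc M K)) M

open Term in
/-- Signature check. -/
inductive CheckAx : Axioms
  | check (K M) : CheckAx (checksig (pks K) (sig K M)) M

open Term in
/-- Blinding commutes with signing. -/
inductive BlindAx : Axioms
  | blind (M K N) : BlindAx (smult M (sig K N)) (sig K (smult M N))

open Term in
/-- Check of a blinded signature, returning the blinded message. -/
inductive BlindCheckAx : Axioms
  | check (M K N) : BlindCheckAx (checksig (pks K) (smult M (sig K N))) (smult M N)

/-- The theory of the original protocol. -/
def E₀ : Axioms := ScalarAx ⊔ DestructorAx ⊔ CheckAx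

/-- The theory of the fixed protocol. -/
def E : Axioms := E₀ ⊔ BlindAx

/-- The approximated theory of the original protocol, as used with ProVerif. -/
def approxE₀ : Axioms := DHAx ⊔ DestructorAx ⊔ CheckAx

/-- The approximated theory of the fixed protocol, as used with ProVerif. -/
def approxE : Axioms := DHAx ⊔ DestructorAx ⊔ BlindCheckAx

/-! ## Processes of the applied pi-calculus -/

inductive Proc : Type
  | nil
  /-- `send M N P` sends `N` on the channel `M` and continues as `P`. -/
  | send (M N : Term) (P : Proc)
  /-- `recv M P` receives a message on the channel `M`, bound to the variable `0` in `P`. -/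
  | recv (M : Term) (P : Proc)
  /-- `nu P` binds the new private name `0` in `P`. -/
  | nu (P : Proc)
  | par (P Q : Proc)
  | rep (P : Proc)
  /-- `mat M N P` continues as `P` if `M` and `N` are equal. -/
  | mat (M N : Term) (P : Proc)

namespace Proc

/-- Capture-avoiding substitution. -/
def subst : Subst → Proc → Proc
  | _, nil => nil
  | σ, send M N P => send (M.subst σ) (N.subst σ) (P.subst σ)
  | σ, recv M P => recv (M.subst σ) (P.subst σ.lift)
  | σ, nu P => nu (P.subst σ.lift)
  | σ, par P Q => par (P.subst σ) (Q.subst σ)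
  | σ, rep P => rep (P.subst σ)
  | σ, mat M N P => mat (M.subst σ) (N.subst σ) (P.subst σ)

/-- The same process, seen from underneath one more binder. -/
def up (P : Proc) : Proc := P.subst fun x => Term.var (x + 1)

/-- The variable `u` does not occur free in the process. -/
def Fresh : ℕ → Proc → Prop
  | _, nil => True
  | u, send M N P => M.Fresh u ∧ N.Fresh u ∧ P.Fresh u
  | u, recv M P => M.Fresh u ∧ P.Fresh (u + 1)
  | u, nu P => P.Fresh (u + 1)
  | u, par P Q => P.Fresh u ∧ Q.Fresh u
  | u, rep P => P.Fresh u
  | u, mat M N P => M.Fresh u ∧ N.Fresh u ∧ P.Fresh u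

end Proc

/-- Extended processes: `base σ P` consists of the frame `σ` (the messages sent so far, available
through the variables in the domain of `σ`) and the future actions `P`; `nu A` binds the private
name `0` in `A`. -/
inductive Ext : Type
  | base (σ : Subst) (P : Proc)
  | nu (A : Ext)

namespace Ext

/-- `ν x⃗.(ρ ∣ R)` becomes `ν x⃗.(ρ ∣ R ∣ Q)`, where no name in `x⃗` occurs in `Q`. -/
def parRight : Ext → Proc → Ext
  | base ρ R, Q => base ρ (.par R Q)
  | nu A, Q => nu (A.parRight Q.up)

/-- `ν x⃗.(ρ ∣ R)` becomes `ν x⃗.(ρ ∣ Q ∣ R)`, where no name in `x⃗` occurs in `Q`. -/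
def parLeft : Proc → Ext → Ext
  | Q, base ρ R => base ρ (.par Q R)
  | Q, nu A => nu (parLeft Q.up A)

/-- `A` satisfies `M = N`: the two recipes, which contain no private name of `A`, are equal under
the frame of `A`. -/
def Sat (Ax : Axioms) : Ext → Term → Term → Prop
  | base σ _, M, N => EqE Ax (M.subst σ) (N.subst σ)
  | nu A, M, N => A.Sat Ax M.up N.up

end Ext

/-- Transition labels. -/
inductive Label : Type
  | tau
  /-- Output, on the channel `M`, of a message that becomes available as the variable `u`. -/
  | out (M : Term) (u : ℕ)
  /-- Input, on the channel `M`, of the message `N`. -/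
  | inp (M N : Term)

namespace Label

def up : Label → Label
  | tau => tau
  | out M u => out M.up (u + 1)
  | inp M N => inp M.up N.up

/-- The bound name of the label, if any, does not occur free in `Q`. -/
def BnFresh : Label → Proc → Prop
  | out _ u, Q => Q.Fresh u
  | _, _ => True

end Label

/-- The labelled transition system. That the private names do not occur in the label, the frame
or the parallel components, where this is required, is expressed by `up` and `lift`. -/
inductive Step (Ax : Axioms) : Ext → Label → Ext → Prop
  | inp {σ K P M N} :
      EqE Ax (M.subst σ) K →
      Step Ax (.base σ (.recv K P)) (.inp M N) (.base σ (P.subst (.inst (N.subst σ))))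
  /-- As `u` is fresh for `σ`, the new frame is the composition of `σ` with `u ↦ N`. -/
  | out {σ K N P M u} :
      EqE Ax (M.subst σ) K → M.Fresh u → N.Fresh u → P.Fresh u → σ.Fresh u →
      Step Ax (.base σ (.send K N P)) (.out M u) (.base (Function.update σ u N) P)
  | mat {σ M N P l A} :
      Step Ax (.base σ P) l A → EqE Ax M N → Step Ax (.base σ (.mat M N P)) l A
  | res {A l B} :
      Step Ax A l.up B → Step Ax (.nu A) l (.nu B)
  | extrusion {σ P l B} :
      Step Ax (.base σ.lift P) l.up B → Step Ax (.base σ (.nu P)) l (.nu B)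
  | rep {σ P l B} :
      Step Ax (.base σ P) l B → l.BnFresh P →
      Step Ax (.base σ (.rep P)) l (B.parRight (.rep P))
  | parL {σ P Q l B} :
      Step Ax (.base σ P) l B → l.BnFresh Q →
      Step Ax (.base σ (.par P Q)) l (B.parRight Q)
  | parR {σ P Q l B} :
      Step Ax (.base σ P) l B → l.BnFresh Q →
      Step Ax (.base σ (.par Q P)) l (B.parLeft Q)

/-- `Run Ax A ls B`: the extended process `A` reaches `B` by the sequence of labels `ls`. -/
inductive Run (Ax : Axioms) : Ext → List Label → Ext → Prop
  | nil (A) : Run Ax A [] A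
  | cons {A l A' ls B} : Step Ax A l A' → Run Ax A' ls B → Run Ax A (l :: ls) B

/-! ## Injective agreement -/

/-- The public channels `out`, `card` and `term`, which are free variables of the system. -/
def outName : ℕ := 0

def cardName : ℕ := 1

def termName : ℕ := 2

/-- The action of the run at position `i` is the output of the message `u` on the channel `ch`,
where channels are compared in the final state `B` of the run. -/
def SendsAt (Ax : Axioms) (ls : List Label) (B : Ext) (i : ℕ) (ch : Term) (u : ℕ) : Prop :=
  ∃ M, ls[i]? = some (.out M u) ∧ B.Sat Ax M ch

/-- The action of the run at position `i` is the input of the message `N` on the channel `ch`,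
where channels are compared in the final state `B` of the run. -/
def ReceivesAt (Ax : Axioms) (ls : List Label) (B : Ext) (i : ℕ) (ch N : Term) : Prop :=
  ∃ M, ls[i]? = some (.inp M N) ∧ B.Sat Ax M ch

/-- In every execution there is an injection `f` such that, whenever a terminal signals `auth` at
position `a`, on its session channel `chT`, the following holds. On `chT` the terminal received
`Mi`, sent `uj` and received `Mk`; a card announced a session channel `chC` at position `f a`, and
on `chC` it sent `ui`, received `Mj` and sent `uk`, all before `a`; and the messages agree. -/
def InjectiveAgreement (Ax : Axioms) (S : Proc) : Prop :=
  ∀ (ls : List Label) (B : Ext), Run Ax (.base .id S) ls B →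
    ∃ f : ℕ → ℕ, Function.Injective f ∧
      ∀ (a : ℕ) (chT : Term) (w : ℕ), 0 < a → ls[a]? = some (.out chT w) →
        B.Sat Ax (.var w) .auth →
        ∃ (i j k i' j' k' : ℕ) (chC ui uj uk : ℕ) (Mi Mj Mk : Term),
          (i < j ∧ j < k ∧ k < a ∧
            ReceivesAt Ax ls B i chT Mi ∧
            SendsAt Ax ls B j chT uj ∧
            ReceivesAt Ax ls B k chT Mk) ∧
          (f a < i' ∧ i' < j' ∧ j' < k' ∧ k' < a ∧
            SendsAt Ax ls B (f a) (.var cardName) chC ∧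
            SendsAt Ax ls B i' (.var chC) ui ∧
            ReceivesAt Ax ls B j' (.var chC) Mj ∧
            SendsAt Ax ls B k' (.var chC) uk) ∧
          (B.Sat Ax (.var ui) Mi ∧ B.Sat Ax (.var uj) Mj ∧ B.Sat Ax (.var uk) Mk)

/-! ## The two protocols -/

open Term Proc

/-- The symmetric key computed by the card, from its blinding factor `a`, its secret key `c` and
the received point `y`. -/
def cardKey (a c y : Term) : Term := hash (smult (mult a c) y)

/-- The same key in the approximated theories, where there is no multiplication of scalars. -/
def approxCardKey (a c y : Term) : Term := hash (smult a (smult c y))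

/-- The card of the original protocol, with payment system key `s`, secret key `c` and session
channel `ch`. -/
def bdhCard (key : Term → Term → Term → Term) (s c ch : Term) : Proc :=
  nu <|
  -- here `var 0` is `a`
  send ch.up (smult (var 0) (smult c.up g)) <|
  recv ch.up <|
  -- here `var 0` is `y` and `var 1` is `a`
  let a : Term := var 1
  let y : Term := var 0
  let pkc : Term := smult c.up.up g
  let cert : Term := pair pkc (sig s.up.up pkc)
  send ch.up.up (enc (pair (pair a pkc) cert) (key a c.up.up y)) <|
  nil

/-- The card of the fixed protocol. -/
def fixCard (key : Term → Term → Term → Term) (s c ch : Term) : Proc :=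
  nu <|
  -- here `var 0` is `a`
  send ch.up (smult (var 0) (smult c.up g)) <|
  recv ch.up <|
  -- here `var 0` is `y` and `var 1` is `a`
  let a : Term := var 1
  let y : Term := var 0
  let pkc : Term := smult c.up.up g
  let m : Term := pair (smult a pkc) (smult a (sig s.up.up pkc))
  send ch.up.up (enc m (key a c.up.up y)) <|
  nil

/-- The terminal of the original protocol. -/
def bdhTerminal (s ch : Term) : Proc :=
  nu <|
  -- here `var 0` is `t`
  recv ch.up <|
  -- here `var 0` is `z₁` and `var 1` is `t`
  send ch.up.up (smult (var 1) g) <|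
  recv ch.up.up <|
  -- here `var 0` is `z₂`, `var 1` is `z₁` and `var 2` is `t`
  let t : Term := var 2
  let z₁ : Term := var 1
  let z₂ : Term := var 0
  let kt : Term := hash (smult t z₁)
  let m₁ : Term := fst (dec kt z₂)
  let m₂ : Term := snd (dec kt z₂)
  mat (snd m₁) (checksig (pks s.up.up.up) (snd m₂)) <|
  mat (smult (fst m₁) (snd m₁)) z₁ <|
  send ch.up.up.up auth <|
  nil

/-- The terminal of the fixed protocol. -/
def fixTerminal (s ch : Term) : Proc :=
  nu <|
  -- here `var 0` is `t`
  recv ch.up <|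
  -- here `var 0` is `z₁` and `var 1` is `t`
  send ch.up.up (smult (var 1) g) <|
  recv ch.up.up <|
  -- here `var 0` is `z₂`, `var 1` is `z₁` and `var 2` is `t`
  let t : Term := var 2
  let z₁ : Term := var 1
  let z₂ : Term := var 0
  let kt : Term := hash (smult t z₁)
  let m₁ : Term := fst (dec kt z₂)
  let m₂ : Term := snd (dec kt z₂)
  mat m₁ (checksig (pks s.up.up.up) m₂) <|
  mat m₁ z₁ <|
  send ch.up.up.up auth <|
  nil

/-- The system of arbitrarily many cards, each with arbitrarily many sessions, and arbitrarily
many terminal sessions: `ν s.(!ν c.!ν ch.card⟨ch⟩.C(s,c,ch) ∣ out⟨pks s⟩.!ν ch.term⟨ch⟩.T(s,ch))`. -/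
def system (C : Term → Term → Term → Proc) (T : Term → Term → Proc) : Proc :=
  nu <| par
    -- here `var 0` is `s`; inside, `var 2` is `s`, `var 1` is `c` and `var 0` is `ch`
    (rep <| nu <| rep <| nu <|
      send (var cardName).up.up.up (var 0) <|
      C (var 2) (var 1) (var 0))
    -- here `var 0` is `s`; inside, `var 1` is `s` and `var 0` is `ch`
    (send (var outName).up (pks (var 0)) <|
      rep <| nu <|
      send (var termName).up.up (var 0) <|
      T (var 1) (var 0))

def bdhSystem : Proc := system (bdhCard cardKey) bdhTerminal

def fixSystem : Proc := system (fixCard cardKey) fixTerminal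

/-- The original system, written without multiplication of scalars. -/
def approxBdhSystem : Proc := system (bdhCard approxCardKey) bdhTerminal

/-- The fixed system, written without multiplication of scalars. -/
def approxFixSystem : Proc := system (fixCard approxCardKey) fixTerminal

end EMV

/-!
# Injective agreement of the blinded Diffie-Hellman protocols

Both protocols authenticate the card through the key `h(φ(t, z₁))` of the terminal. A terminal
only accepts if `z₁` is a multiple of a point that passes the signature check. As the signing key
is secret, such a point is either `φ(c, g)` times known scalars, for the secret key `c` of some
card, or a signature check that does not reduce. In both cases `φ(t, z₁)` is out of the
attacker's reach: the attacker only obtains points over `g` with at most one of the secrets `c`,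
`t`, and cannot apply `t` to any other point. Hence the attacker cannot have made the ciphertext
that the terminal accepts, and it comes from a card. Its plaintext determines `z₁ = φ(a, φ(c,
g))`, and cancelling `a` and `c` in the equation of keys `φ(t, z₁) = φ(a, φ(c, y))` shows that
the card received `y = φ(t, g)`. So the card session determines `t`, which makes the agreement
injective.

*Equality.* `nf` computes normal forms by smart constructors that respect the equations; it does
not identify more messages than the theory does (`eqE_iff_nf_eq`). The multiset `scal` of the
scalars of a point, and its `base`, are all that is needed to know about scalar multiplication,
in the exact and in the approximated theories alike (`scal_base_mkSmult`).

*Secrecy.* `Known` over-approximates the normal forms that the attacker can learn. It is closed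
under all operations (`Known.nf_subst`), and the argument above is `Accepts.exists_honest`
followed by `Accepts.agree`. Blinding factors are public here: secrecy of the secret keys
suffices.

*Executions.* `Step.flat` replaces nested restrictions by global private names, so that a state
becomes a frame and a multiset of parallel components. Every component of a reachable state is a
`Session`, which carries the relevant part of its past. The invariant `Inv` is preserved by the
transitions of all kinds of sessions (`Inv.exists_inv`); agreement is established when a terminal
sends `auth` (`Inv.step_verify`).
-/

namespace EMV

/-! ### Normal forms of messages -/

/-- The four combinations of theory and protocol: `approx` chooses the approximated Diffie-Hellman
theory, `fixed` chooses the fixed protocol together with its theory of signatures. -/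
structure Mode where
  approx : Bool
  fixed : Bool

/-- The equational theory of a mode. -/
def Mode.ax : Mode → Axioms
  | ⟨false, false⟩ => E₀
  | ⟨false, true⟩ => E
  | ⟨true, false⟩ => approxE₀
  | ⟨true, true⟩ => approxE

/-- The factors of a scalar; in the approximated theories products are uninterpreted, and
every scalar is its own only factor. -/
def factors (m : Mode) : Term → Multiset Term
  | .mult M N => if m.approx then {.mult M N} else factors m M + factors m N
  | M => {M}

/-- The right-nested product of a nonempty list of scalars, with a junk value at the empty list. -/
def prod : List Term → Term
  | [] => .auth
  | [M] => M
  | M :: N :: l => .mult M (prod (N :: l))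

/-- Multiplication of normal forms: the factors are multiplied in an order that depends on their
multiset only. -/
noncomputable def mkMult (m : Mode) (M N : Term) : Term :=
  if m.approx then .mult M N else prod (factors m M + factors m N).toList

/-- The multiset of all scalars that are applied successively in a point. -/
def scal (m : Mode) : Term → Multiset Term
  | .smult A N => factors m A + scal m N
  | _ => 0

/-- What is left of a point when all scalars have been removed. -/
def base : Term → Term
  | .smult _ N => base N
  | N => N

/-- Scalar multiplication of normal forms in the theories with a multiplication of scalars. In the
fixed protocol the scalar is moved inside of signatures. -/
noncomputable def actSmult (m : Mode) (A : Term) : Term → Term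
  | .smult B N => .smult (mkMult m A B) N
  | .sig K N => if m.fixed then .sig K (actSmult m A N) else .smult A (.sig K N)
  | N => .smult A N

/-- The point obtained from `g` by the scalars of a multiset, applied in an order that depends on
the multiset only. -/
noncomputable def chain (s : Multiset Term) : Term := s.toList.foldr .smult .g

open Classical in
/-- Scalar multiplication of normal forms: in the approximated theories exactly the three innermost
scalars above `g` commute, so only these are sorted. -/
noncomputable def mkSmult (m : Mode) (A N : Term) : Term :=
  if m.approx then
    if base N = .g ∧ (scal m N).card ≤ 2 then chain (A ::ₘ scal m N) else .smult A N
  else actSmult m A N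

/-- First projection of normal forms. -/
def mkFst : Term → Term
  | .pair M _ => M
  | M => .fst M

/-- Second projection of normal forms. -/
def mkSnd : Term → Term
  | .pair _ N => N
  | M => .snd M

open Classical in
/-- Decryption of normal forms; it does not reduce unless the keys agree. -/
noncomputable def mkDec (K : Term) : Term → Term
  | .enc M K' => if K' = K then M else .dec K (.enc M K')
  | M => .dec K M

open Classical in
/-- Signature check of normal forms. The approximated theory of the fixed protocol only checks
blinded signatures. -/
noncomputable def mkCheck (m : Mode) : Term → Term → Term
  | .pks K, .sig K' M =>
    if m.approx ∧ m.fixed then .checksig (.pks K) (.sig K' M)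
    else if K = K' then M else .checksig (.pks K) (.sig K' M)
  | .pks K, .smult A (.sig K' M) =>
    if m.approx ∧ m.fixed ∧ K = K' then mkSmult m A M
    else .checksig (.pks K) (.smult A (.sig K' M))
  | V, M => .checksig V M

/-- The normal form of a message. -/
noncomputable def nf (m : Mode) : Term → Term
  | .var x => .var x
  | .g => .g
  | .mult M N => mkMult m (nf m M) (nf m N)
  | .smult M N => mkSmult m (nf m M) (nf m N)
  | .pair M N => .pair (nf m M) (nf m N)
  | .hash M => .hash (nf m M)
  | .pks K => .pks (nf m K)
  | .sig K M => .sig (nf m K) (nf m M)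
  | .enc M K => .enc (nf m M) (nf m K)
  | .dec K M => mkDec (nf m K) (nf m M)
  | .checksig V M => mkCheck m (nf m V) (nf m M)
  | .fst M => mkFst (nf m M)
  | .snd M => mkSnd (nf m M)
  | .auth => .auth

theorem factors_approx {m : Mode} (h : m.approx = true) (M : Term) : factors m M = {M} := by
  cases M <;> simp [factors, h]

theorem card_factors_pos (m : Mode) (M : Term) : 0 < (factors m M).card := by
  induction M <;> simp only [factors] <;> try simp
  split
  · simp
  · rw [Multiset.card_add]; omega

theorem factors_factor {m : Mode} {M f : Term} (hf : f ∈ factors m M) : factors m f = {f} := by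
  induction M with
  | mult M N ihM ihN =>
    by_cases h : m.approx
    · exact factors_approx h f
    · simp only [factors, h, Bool.false_eq_true, if_false, Multiset.mem_add] at hf
      exact hf.elim ihM ihN
  | _ => simp only [factors, Multiset.mem_singleton] at hf; subst hf; simp [factors]

theorem eq_of_factors_eq_singleton {m : Mode} {M f : Term} (h : factors m M = {f}) : M = f := by
  cases M with
  | mult M N =>
    by_cases ha : m.approx
    · simpa [factors, ha] using h
    · simp only [factors, ha, Bool.false_eq_true, if_false] at h
      have h1 := card_factors_pos m M
      have h2 := card_factors_pos m N
      have h3 := congrArg Multiset.card h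
      simp at h3; omega
  | _ => simpa [factors] using h

theorem factors_prod {m : Mode} (ha : m.approx = false) {l : List Term} (hl : l ≠ [])
    (h : ∀ f ∈ l, factors m f = {f}) : factors m (prod l) = l := by
  induction l with
  | nil => exact absurd rfl hl
  | cons M l ih =>
    cases l with
    | nil => simpa [prod] using h M (by simp)
    | cons N l =>
      simp only [prod, factors, ha, Bool.false_eq_true, if_false]
      rw [ih (by simp) fun f hf => h f (List.mem_cons_of_mem _ hf), h M (by simp)]
      simp

theorem factors_mkMult {m : Mode} (ha : m.approx = false) (M N : Term) :
    factors m (mkMult m M N) = factors m M + factors m N := by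
  have h1 := card_factors_pos m M
  simp only [mkMult, ha, Bool.false_eq_true, if_false]
  rw [factors_prod ha, Multiset.coe_toList]
  · intro h
    have := congrArg List.length h
    rw [Multiset.length_toList, Multiset.card_add, List.length_nil] at this
    omega
  · intro f hf
    rw [Multiset.mem_toList, Multiset.mem_add] at hf
    exact hf.elim factors_factor factors_factor

theorem mkMult_comm {m : Mode} (ha : m.approx = false) (M N : Term) :
    mkMult m M N = mkMult m N M := by
  simp [mkMult, ha, add_comm]

theorem mkMult_assoc {m : Mode} (ha : m.approx = false) (M N K : Term) :
    mkMult m (mkMult m M N) K = mkMult m M (mkMult m N K) := by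
  rw [mkMult, mkMult.eq_1 m M (mkMult m N K), factors_mkMult ha, factors_mkMult ha, add_assoc]
  simp [ha]

theorem actSmult_mkMult {m : Mode} (ha : m.approx = false) (M N K : Term) :
    actSmult m (mkMult m M N) K = actSmult m M (actSmult m N K) := by
  induction K <;> simp only [actSmult, mkMult_assoc ha]
  split <;> simp_all [actSmult]

theorem scal_chain {m : Mode} (ha : m.approx = true) (s : Multiset Term) :
    scal m (chain s) = s := by
  rw [chain]
  conv_rhs => rw [← Multiset.coe_toList s]
  induction s.toList <;> simp_all [scal, factors_approx]

theorem base_chain (s : Multiset Term) : base (chain s) = .g := by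
  rw [chain]
  induction s.toList <;> simp_all [base]

theorem chain_singleton (A : Term) : chain {A} = .smult A .g := by
  simp [chain]

/-- The normal form is invariant under the equations. -/
theorem EqE.nf_eq {m : Mode} {M N : Term} (h : EqE m.ax M N) : nf m M = nf m N := by
  induction h with
  | ax h =>
    -- Each group of axioms is sound in all modes whose theory contains it.
    have hS : ∀ {M N}, m.approx = false → ScalarAx M N → nf m M = nf m N := by
      rintro M N ha (_ | _ | _)
      · exact mkMult_comm ha _ _
      · exact mkMult_assoc ha _ _ _
      · simp [nf, mkSmult, ha, actSmult_mkMult ha]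
    have hDH : ∀ {M N}, m.approx = true → DHAx M N → nf m M = nf m N := by
      rintro M N ha (_ | _)
      · simp [nf, mkSmult, ha, base, scal, base_chain, scal_chain ha]
        rw [← Multiset.insert_eq_cons, Multiset.pair_comm, Multiset.insert_eq_cons]
      · simp [nf, mkSmult, ha, base, scal, base_chain, scal_chain ha]
        rw [Multiset.cons_swap]
    have hD : ∀ {M N}, DestructorAx M N → nf m M = nf m N := by
      rintro M N (_ | _ | _)
      · rfl
      · rfl
      · simp [nf, mkDec]
    obtain ⟨_ | _, _ | _⟩ := m
    · rcases h with (h | h) | h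
      · exact hS rfl h
      · exact hD h
      · cases h; simp [nf, mkCheck]
    · rcases h with ((h | h) | h) | h
      · exact hS rfl h
      · exact hD h
      · cases h; simp [nf, mkCheck]
      · cases h; simp [nf, mkSmult, actSmult]
    · rcases h with (h | h) | h
      · exact hDH rfl h
      · exact hD h
      · cases h; simp [nf, mkCheck]
    · rcases h with (h | h) | h
      · exact hDH rfl h
      · exact hD h
      · obtain ⟨A, K, B⟩ := h
        simp [nf, mkSmult, base, mkCheck]
  | refl => rfl
  | symm _ ih => exact ih.symm
  | trans _ _ ih1 ih2 => exact ih1.trans ih2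
  | _ => simp_all [nf]

theorem EqE.of_eq {Ax : Axioms} {M N : Term} (h : M = N) : EqE Ax M N := h ▸ .refl M

theorem ScalarAx.eqE {m : Mode} (ha : m.approx = false) {M N : Term} (h : ScalarAx M N) :
    EqE m.ax M N := by
  obtain ⟨_ | _, _ | _⟩ := m <;> simp at ha
  · exact .ax (Or.inl (Or.inl h))
  · exact .ax (Or.inl (Or.inl (Or.inl h)))

theorem DHAx.eqE {m : Mode} (ha : m.approx = true) {M N : Term} (h : DHAx M N) :
    EqE m.ax M N := by
  obtain ⟨_ | _, _ | _⟩ := m <;> simp at ha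
  · exact .ax (Or.inl (Or.inl h))
  · exact .ax (Or.inl (Or.inl h))

theorem DestructorAx.eqE {m : Mode} {M N : Term} (h : DestructorAx M N) : EqE m.ax M N := by
  obtain ⟨_ | _, _ | _⟩ := m
  · exact .ax (Or.inl (Or.inr h))
  · exact .ax (Or.inl (Or.inl (Or.inr h)))
  · exact .ax (Or.inl (Or.inr h))
  · exact .ax (Or.inl (Or.inr h))

/-- The order of the factors does not matter modulo the theory. -/
theorem prod_perm {m : Mode} (ha : m.approx = false) {l l' : List Term} (h : l.Perm l') :
    EqE m.ax (prod l) (prod l') := by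
  induction h with
  | nil => exact .refl _
  | @cons M l l' hp ih =>
    cases l with
    | nil => rw [List.nil_perm.1 hp]; exact .refl _
    | cons N l =>
      cases l' with
      | nil => exact absurd hp.symm (by simp)
      | cons N' l' => exact .mult (.refl _) ih
  | swap M N l =>
    cases l with
    | nil => exact (ScalarAx.comm _ _).eqE ha
    | cons K l =>
      exact ((ScalarAx.assoc _ _ _).eqE ha).symm.trans
        ((EqE.mult ((ScalarAx.comm _ _).eqE ha) (.refl _)).trans ((ScalarAx.assoc _ _ _).eqE ha))
  | trans _ _ ih1 ih2 => exact ih1.trans ih2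

theorem prod_append {m : Mode} (ha : m.approx = false) {l l' : List Term} (h : l ≠ [])
    (h' : l' ≠ []) : EqE m.ax (prod (l ++ l')) (.mult (prod l) (prod l')) := by
  induction l with
  | nil => exact absurd rfl h
  | cons M l ih =>
    cases l with
    | nil =>
      cases l' with
      | nil => exact absurd rfl h'
      | cons N l' => exact .refl _
    | cons K l =>
      exact (EqE.mult (.refl _) (ih (by simp))).trans ((ScalarAx.assoc _ _ _).eqE ha).symm

theorem toList_factors_ne_nil (m : Mode) (M : Term) : (factors m M).toList ≠ [] := by
  intro h
  have := congrArg List.length h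
  rw [Multiset.length_toList] at this
  have := card_factors_pos m M
  simp_all

theorem prod_add {m : Mode} (ha : m.approx = false) (M N : Term) :
    EqE m.ax (prod (factors m M + factors m N).toList)
      (.mult (prod (factors m M).toList) (prod (factors m N).toList)) := by
  refine (prod_perm ha ?_).trans
    (prod_append ha (toList_factors_ne_nil m M) (toList_factors_ne_nil m N))
  rw [← Multiset.coe_eq_coe, ← Multiset.coe_add]
  simp only [Multiset.coe_toList]

theorem prod_factors {m : Mode} (ha : m.approx = false) (M : Term) :
    EqE m.ax (prod (factors m M).toList) M := by
  induction M with
  | mult M N ihM ihN =>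
    simp only [factors, ha, Bool.false_eq_true, if_false]
    exact (prod_add ha M N).trans (ihM.mult ihN)
  | _ => simp only [factors, Multiset.toList_singleton]; exact .refl _

theorem mkMult_eqE (m : Mode) (M N : Term) : EqE m.ax (mkMult m M N) (.mult M N) := by
  by_cases ha : m.approx
  · simp only [mkMult, ha, if_true]; exact .refl _
  · simp only [mkMult, ha, Bool.false_eq_true, if_false]
    simp only [Bool.not_eq_true] at ha
    exact (prod_add ha M N).trans ((prod_factors ha M).mult (prod_factors ha N))

theorem actSmult_eqE {m : Mode} (ha : m.approx = false) (A N : Term) :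
    EqE m.ax (actSmult m A N) (.smult A N) := by
  induction N with
  | smult B N =>
    exact (EqE.smult (mkMult_eqE m A B) (.refl _)).trans ((ScalarAx.act _ _ _).eqE ha)
  | sig K N _ ih =>
    simp only [actSmult]
    split
    · refine (EqE.sig (.refl _) ih).trans (.symm ?_)
      obtain ⟨_ | _, _ | _⟩ := m <;> simp_all
      exact .ax (Or.inr (.blind _ _ _))
    · exact .refl _
  | _ => exact .refl _

/-- At most three scalars above `g` commute modulo the approximated theory. -/
theorem chain_foldr_perm {m : Mode} (ha : m.approx = true) {l l' : List Term} (h : l.Perm l')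
    (hl : l.length ≤ 3) : EqE m.ax (l.foldr .smult .g) (l'.foldr .smult .g) := by
  induction h with
  | nil => exact .refl _
  | cons M _ ih => exact .smult (.refl _) (ih (by simp at hl; omega))
  | swap M N l =>
    match l, hl with
    | [], _ => exact (DHAx.swap _ _).eqE ha
    | [K], _ => exact (DHAx.swapBlinded _ _ _).eqE ha
    | _ :: _ :: _, hl => simp at hl; omega
  | trans h1 _ ih1 ih2 => exact (ih1 hl).trans (ih2 (h1.length_eq ▸ hl))

/-- A point over `g` is obtained from `g` by the list of its scalars. -/
theorem exists_list_of_base_eq {m : Mode} (ha : m.approx = true) {N : Term} (h : base N = .g) :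
    ∃ l : List Term, scal m N = l ∧ N = l.foldr .smult .g := by
  induction N with
  | g => exact ⟨[], rfl, rfl⟩
  | smult A N _ ih =>
    obtain ⟨l, h1, h2⟩ := ih h
    exact ⟨A :: l, by simp [scal, factors_approx ha, h1], by simp [← h2]⟩
  | _ => simp [base] at h

theorem mkSmult_eqE (m : Mode) (A N : Term) : EqE m.ax (mkSmult m A N) (.smult A N) := by
  rw [mkSmult]
  split_ifs with ha h
  · obtain ⟨l, h1, h2⟩ := exists_list_of_base_eq ha h.1
    rw [h1] at h
    rw [h1]
    conv_rhs => rw [h2]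
    change EqE _ _ ((A :: l).foldr .smult .g)
    have hp : (A ::ₘ (l : Multiset Term)).toList.Perm (A :: l) := by
      rw [← Multiset.coe_eq_coe]; simp
    refine chain_foldr_perm ha hp ?_
    rw [hp.length_eq]; simpa [Nat.lt_succ_iff] using h.2
  · exact .refl _
  · exact actSmult_eqE (by simpa using ha) A N

theorem mkCheck_eqE (m : Mode) (V M : Term) : EqE m.ax (mkCheck m V M) (.checksig V M) := by
  have hC : ∀ {M N}, ¬ (m.approx = true ∧ m.fixed = true) → CheckAx M N → EqE m.ax M N := by
    intro M N h hc
    obtain ⟨_ | _, _ | _⟩ := m <;> simp at h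
    · exact .ax (Or.inr hc)
    · exact .ax (Or.inl (Or.inr hc))
    · exact .ax (Or.inr hc)
  unfold mkCheck
  split
  · split_ifs with h h'
    · exact .refl _
    · subst h'; exact (hC h (.check _ _)).symm
    · exact .refl _
  · split_ifs with h
    · obtain ⟨h1, h2, rfl⟩ := h
      refine (mkSmult_eqE m _ _).trans (.symm ?_)
      obtain ⟨_ | _, _ | _⟩ := m <;> simp at h1 h2
      exact .ax (Or.inr (.check _ _ _))
    · exact .refl _
  · exact .refl _

theorem nf_eqE (m : Mode) (M : Term) : EqE m.ax (nf m M) M := by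
  induction M with
  | var => exact .refl _
  | g => exact .refl _
  | auth => exact .refl _
  | mult M N h1 h2 => exact (mkMult_eqE m _ _).trans (h1.mult h2)
  | smult M N h1 h2 => exact (mkSmult_eqE m _ _).trans (h1.smult h2)
  | pair M N h1 h2 => exact h1.pair h2
  | hash M h => exact h.hash
  | pks M h => exact h.pks
  | sig M N h1 h2 => exact h1.sig h2
  | enc M N h1 h2 => exact h1.enc h2
  | dec K M h1 h2 =>
    refine .trans ?_ (h1.dec h2)
    rw [nf]
    generalize nf m K = K', nf m M = M'
    unfold mkDec
    split
    · split_ifs with h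
      · subst h; exact (DestructorAx.dec _ _).eqE.symm
      · exact .refl _
    · exact .refl _
  | checksig V M h1 h2 => exact (mkCheck_eqE m _ _).trans (h1.checksig h2)
  | fst M h =>
    refine .trans ?_ h.fst
    rw [nf]
    generalize nf m M = M'
    unfold mkFst
    split
    · exact (DestructorAx.fst _ _).eqE.symm
    · exact .refl _
  | snd M h =>
    refine .trans ?_ h.snd
    rw [nf]
    generalize nf m M = M'
    unfold mkSnd
    split
    · exact (DestructorAx.snd _ _).eqE.symm
    · exact .refl _

/-- Two messages are equal modulo the theory iff they have the same normal form. -/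
theorem eqE_iff_nf_eq {m : Mode} {M N : Term} : EqE m.ax M N ↔ nf m M = nf m N :=
  ⟨EqE.nf_eq, fun h => (nf_eqE m M).symm.trans ((EqE.of_eq h).trans (nf_eqE m N))⟩

/-! ### Scalars and bases of points -/

/-- Scalar multiplication adds to the scalars and keeps the base, except where it moves inside of a
signature. -/
theorem scal_base_mkSmult {m : Mode} (A : Term) {N : Term}
    (h : m.approx = true ∨ m.fixed = false ∨ ∀ K M, N ≠ .sig K M) :
    scal m (mkSmult m A N) = factors m A + scal m N ∧ base (mkSmult m A N) = base N := by
  rw [mkSmult]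
  split_ifs with ha hb
  · rw [scal_chain ha, base_chain, factors_approx ha, hb.1]; simp
  · exact ⟨rfl, rfl⟩
  · have ha : m.approx = false := by simpa using ha
    cases N with
    | sig K M =>
      have hf : m.fixed = false := by simpa [ha] using h
      simp [actSmult, hf, scal, base]
    | smult B N => simp [actSmult, scal, base, factors_mkMult ha, add_assoc]
    | _ => simp [actSmult, scal, base]

theorem mkSmult_sig {m : Mode} (ha : m.approx = false) (hf : m.fixed = true) (A K M : Term) :
    mkSmult m A (.sig K M) = .sig K (mkSmult m A M) := by
  simp [mkSmult, ha, actSmult, hf]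

theorem base_eq_of_mkSmult {m : Mode} {A N : Term} (h : base (mkSmult m A N) = .g) :
    base N = .g := by
  by_cases h' : m.approx = true ∨ m.fixed = false ∨ ∀ K M, N ≠ .sig K M
  · rwa [(scal_base_mkSmult A h').2] at h
  · push Not at h'
    obtain ⟨ha, hf, K, M, rfl⟩ := h'
    rw [mkSmult_sig (by simpa using ha) (by simpa using hf)] at h
    simp [base] at h

theorem scal_mkSmult_of_base {m : Mode} (A : Term) {N : Term} (h : base N = .g) :
    scal m (mkSmult m A N) = factors m A + scal m N :=
  (scal_base_mkSmult A (.inr (.inr fun K M hN => by subst hN; simp [base] at h))).1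

theorem base_mkSmult_of_base (m : Mode) (A : Term) {N : Term} (h : base N = .g) :
    base (mkSmult m A N) = .g :=
  (scal_base_mkSmult A (.inr (.inr fun K M hN => by subst hN; simp [base] at h))).2.trans h

theorem mkSmult_g (m : Mode) (A : Term) : mkSmult m A .g = .smult A .g := by
  by_cases ha : m.approx <;> simp [mkSmult, ha, actSmult, base, scal, chain_singleton]

theorem mkSmult_checksig (m : Mode) (A V M : Term) :
    mkSmult m A (.checksig V M) = .smult A (.checksig V M) := by
  by_cases ha : m.approx <;> simp [mkSmult, ha, actSmult, base]

/-- A point with base `g` and a single scalar that is a name. -/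
theorem eq_smult_g_of_scal {m : Mode} {N f : Term} (hb : base N = .g) (hs : scal m N = {f}) :
    N = .smult f .g := by
  cases N with
  | smult A N =>
    simp only [scal] at hs
    have h1 := card_factors_pos m A
    have h2 := congrArg Multiset.card hs
    simp only [Multiset.card_add, Multiset.card_singleton] at h2
    have h3 : scal m N = 0 := Multiset.card_eq_zero.1 (by omega)
    rw [h3, add_zero] at hs
    rw [eq_of_factors_eq_singleton hs]
    cases N with
    | smult B N =>
      have := card_factors_pos m B
      have := congrArg Multiset.card h3
      simp only [scal, Multiset.card_add, Multiset.card_zero] at this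
      omega
    | _ => simp_all [base]
  | _ => simp [scal] at hs

/-! ### Messages that an attacker may know -/

/-- What a name is used for. Blinding factors and session channels count as public. -/
inductive Role
  | pub
  /-- the signing key of the payment system -/
  | signing
  /-- the secret key of a card -/
  | card
  /-- the secret key of a terminal session -/
  | terminal
  | unused

/-- A name that is used as a secret Diffie-Hellman scalar. -/
def Role.Secret (r : Role) : Prop := r = .card ∨ r = .terminal

/-- An over-approximation of the normal forms that an attacker may know. Here `role` tells what the
names are used for, `var 1` is the signing key, and `hon M K` means that some card has sent the
encryption of `M` with the key `K`. A secret scalar is only known through points over `g`, each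
with a single secret scalar, and through signatures on such points. -/
inductive Known (m : Mode) (role : ℕ → Role) (hon : Term → Term → Prop) : Term → Prop
  | var {x} : role x = .pub → Known m role hon (.var x)
  | g : Known m role hon .g
  | auth : Known m role hon .auth
  | mult {M N} : Known m role hon M → Known m role hon N → Known m role hon (.mult M N)
  | smult {M N} : Known m role hon M → Known m role hon N → Known m role hon (.smult M N)
  | point {M N x S} : (role x).Secret → base N = .g → scal m (.smult M N) = .var x ::ₘ S →
      (∀ f ∈ S, Known m role hon f) → Known m role hon (.smult M N)
  | pair {M N} : Known m role hon M → Known m role hon N → Known m role hon (.pair M N)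
  | hash {M} : Known m role hon M → Known m role hon (.hash M)
  | pks {K} : Known m role hon K → Known m role hon (.pks K)
  | pksSigning : Known m role hon (.pks (.var 1))
  | sig {K M} : Known m role hon K → Known m role hon M → Known m role hon (.sig K M)
  | cert {M x S} : role x = .card → base M = .g → scal m M = .var x ::ₘ S →
      (∀ f ∈ S, Known m role hon f) → Known m role hon (.sig (.var 1) M)
  | enc {M K} : Known m role hon M → Known m role hon K → Known m role hon (.enc M K)
  | honest {M K} : Known m role hon M → hon M K → Known m role hon (.enc M K)
  | dec {K M} : Known m role hon K → Known m role hon M → Known m role hon (.dec K M)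
  | checksig {V M} : Known m role hon V → Known m role hon M → Known m role hon (.checksig V M)
  | fst {M} : Known m role hon M → Known m role hon (.fst M)
  | snd {M} : Known m role hon M → Known m role hon (.snd M)

/-- A point over `g` whose scalars are known, except for one, which is the secret key of a card. -/
def CardPoint (m : Mode) (role : ℕ → Role) (hon : Term → Term → Prop) (M : Term) : Prop :=
  base M = .g ∧ ∃ x S, role x = .card ∧ scal m M = .var x ::ₘ S ∧ ∀ f ∈ S, Known m role hon f

namespace Known

variable {m : Mode} {role : ℕ → Role} {hon : Term → Term → Prop}

/-- Private names may be put to use, and more ciphertexts may be sent. -/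
theorem mono {role' : ℕ → Role} {hon' : Term → Term → Prop}
    (hr : ∀ x, role x ≠ .unused → role' x = role x) (hh : ∀ M K, hon M K → hon' M K) {M : Term}
    (h : Known m role hon M) : Known m role' hon' M := by
  induction h with
  | var h => exact .var (by rw [hr _ (by simp [h]), h])
  | g => exact .g
  | auth => exact .auth
  | mult _ _ h1 h2 => exact .mult h1 h2
  | smult _ _ h1 h2 => exact .smult h1 h2
  | @point M N x S h1 h2 h3 _ h4 =>
    exact .point (by rw [hr x]; exacts [h1, by rcases h1 with h | h <;> simp [h]]) h2 h3 h4
  | pair _ _ h1 h2 => exact .pair h1 h2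
  | hash _ h => exact .hash h
  | pks _ h => exact .pks h
  | pksSigning => exact .pksSigning
  | sig _ _ h1 h2 => exact .sig h1 h2
  | cert h1 h2 h3 _ h4 => exact .cert (by rw [hr _ (by simp [h1]), h1]) h2 h3 h4
  | enc _ _ h1 h2 => exact .enc h1 h2
  | honest _ h h1 => exact .honest h1 (hh _ _ h)
  | dec _ _ h1 h2 => exact .dec h1 h2
  | checksig _ _ h1 h2 => exact .checksig h1 h2
  | fst _ h => exact .fst h
  | snd _ h => exact .snd h

theorem of_mem_factors {M f : Term} (h : Known m role hon M) (hf : f ∈ factors m M) :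
    Known m role hon f := by
  induction M with
  | mult M N ihM ihN =>
    simp only [factors] at hf
    split at hf
    · rw [Multiset.mem_singleton.1 hf]; exact h
    · cases h with | mult h1 h2 => exact (Multiset.mem_add.1 hf).elim (ihM h1) (ihN h2)
  | _ => rw [Multiset.mem_singleton.1 hf]; exact h

theorem of_factors {M : Term} (h : ∀ f ∈ factors m M, Known m role hon f) :
    Known m role hon M := by
  induction M with
  | mult M N ihM ihN =>
    simp only [factors] at h
    split at h
    · exact h _ (by simp)
    · exact .mult (ihM fun f hf => h f (Multiset.mem_add.2 (.inl hf)))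
        (ihN fun f hf => h f (Multiset.mem_add.2 (.inr hf)))
  | _ => exact h _ (by simp [factors])

theorem of_scal {N : Term} (hb : Known m role hon (base N))
    (h : ∀ f ∈ scal m N, Known m role hon f) : Known m role hon N := by
  induction N with
  | smult A N _ ih =>
    exact .smult (of_factors fun f hf => h f (Multiset.mem_add.2 (.inl hf)))
      (ih hb fun f hf => h f (Multiset.mem_add.2 (.inr hf)))
  | _ => exact hb

theorem of_point {N : Term} {x : ℕ} {S : Multiset Term} (hx : (role x).Secret)
    (hb : base N = .g) (hs : scal m N = .var x ::ₘ S) (h : ∀ f ∈ S, Known m role hon f) :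
    Known m role hon N := by
  cases N with
  | smult A N => exact .point hx hb hs h
  | _ => simp [scal] at hs

/-- A known point has at most one secret scalar, and none if its base is not `g`. -/
theorem scal_cases {N : Term} (h : Known m role hon N) :
    (Known m role hon (base N) ∧ ∀ f ∈ scal m N, Known m role hon f) ∨
      (base N = .g ∧ ∃ x S, (role x).Secret ∧ scal m N = .var x ::ₘ S ∧
        ∀ f ∈ S, Known m role hon f) := by
  induction N with
  | smult A N _ ih =>
    cases h with
    | smult hA hN =>
      rcases ih hN with ⟨h1, h2⟩ | ⟨h1, x, S, h2, h3, h4⟩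
      · refine .inl ⟨h1, fun f hf => ?_⟩
        exact (Multiset.mem_add.1 hf).elim (of_mem_factors hA) (h2 f)
      · refine .inr ⟨h1, x, factors m A + S, h2, ?_, fun f hf => ?_⟩
        · simp [scal, h3]
        · exact (Multiset.mem_add.1 hf).elim (of_mem_factors hA) (h4 f)
    | point h1 h2 h3 h4 => exact .inr ⟨h2, _, _, h1, h3, h4⟩
  | _ => exact .inl ⟨h, by simp [scal]⟩

theorem not_var {x : ℕ} (hx : role x ≠ .pub) : ¬ Known m role hon (.var x) := fun h => by
  cases h with | var h => exact hx h

theorem not_secret {x : ℕ} (hx : (role x).Secret) : ¬ Known m role hon (.var x) :=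
  not_var (by rcases hx with h | h <;> simp [h])

/-- A known point does not have two secret scalars. -/
theorem not_two_secrets {N : Term} {x y : ℕ} {S : Multiset Term} (hx : (role x).Secret)
    (hy : (role y).Secret) (hs : scal m N = .var x ::ₘ .var y ::ₘ S) :
    ¬ Known m role hon N := fun h => by
  rcases scal_cases h with ⟨-, h⟩ | ⟨-, z, S', -, h1, h2⟩
  · exact not_secret hx (h _ (by simp [hs]))
  · rw [hs] at h1
    rcases Multiset.cons_eq_cons.1 h1 with ⟨-, h3⟩ | ⟨-, T, -, h3⟩
    · exact not_secret hy (h2 _ (by simp [← h3]))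
    · exact not_secret hx (h2 _ (by simp [h3]))

/-! ### The attacker's knowledge is closed under the operations -/

theorem mkMult {M N : Term} (hM : Known m role hon M) (hN : Known m role hon N) :
    Known m role hon (mkMult m M N) := by
  by_cases ha : m.approx
  · simp only [EMV.mkMult, ha, if_true]; exact .mult hM hN
  · refine of_factors fun f hf => ?_
    rw [factors_mkMult (by simpa using ha), Multiset.mem_add] at hf
    exact hf.elim (of_mem_factors hM) (of_mem_factors hN)

theorem _root_.EMV.CardPoint.mkSmult {A N : Term} (hA : Known m role hon A)
    (hN : CardPoint m role hon N) : CardPoint m role hon (mkSmult m A N) := by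
  obtain ⟨hb, x, S, hx, hs, h⟩ := hN
  refine ⟨base_mkSmult_of_base m A hb, x, factors m A + S, hx, ?_, fun f hf => ?_⟩
  · simp [scal_mkSmult_of_base A hb, hs]
  · exact (Multiset.mem_add.1 hf).elim (of_mem_factors hA) (h f)

theorem _root_.EMV.CardPoint.known {N : Term} (hN : CardPoint m role hon N) :
    Known m role hon N := by
  obtain ⟨hb, x, S, hx, hs, h⟩ := hN
  exact of_point (.inl hx) hb hs h

theorem mkSmult {A N : Term} (hA : Known m role hon A) (hN : Known m role hon N) :
    Known m role hon (mkSmult m A N) := by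
  -- Unless the scalar moves inside of a signature, scalars and base decide.
  have key : ∀ {N}, (m.approx = true ∨ m.fixed = false ∨ ∀ K M, N ≠ .sig K M) →
      Known m role hon N → Known m role hon (EMV.mkSmult m A N) := by
    intro N h hN
    obtain ⟨h1, h2⟩ := scal_base_mkSmult A h
    rcases scal_cases hN with ⟨h3, h4⟩ | ⟨h3, x, S, h4, h5, h6⟩
    · refine of_scal (h2 ▸ h3) fun f hf => ?_
      rw [h1, Multiset.mem_add] at hf
      exact hf.elim (of_mem_factors hA) (h4 f)
    · refine of_point (x := x) (S := factors m A + S) h4 (h2.trans h3) ?_ fun f hf => ?_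
      · simp [h1, h5]
      · exact (Multiset.mem_add.1 hf).elim (of_mem_factors hA) (h6 f)
  by_cases hc : m.approx = true ∨ m.fixed = false
  · exact key (hc.imp_right .inl) hN
  · push Not at hc
    have ha : m.approx = false := by simpa using hc.1
    have hf : m.fixed = true := by simpa using hc.2
    induction N with
    | sig K M _ ih =>
      rw [mkSmult_sig ha hf]
      cases hN with
      | sig hK hM => exact .sig hK (ih hM)
      | cert h1 h2 h3 h4 =>
        obtain ⟨hb, x, S, hx, hs, h⟩ := CardPoint.mkSmult hA ⟨h2, _, _, h1, h3, h4⟩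
        exact .cert hx hb hs h
    | _ => exact key (.inr (.inr (by simp))) hN

theorem mkFst {M : Term} (h : Known m role hon M) : Known m role hon (mkFst M) := by
  unfold EMV.mkFst
  split
  · cases h with | pair h1 h2 => exact h1
  · exact .fst h

theorem mkSnd {M : Term} (h : Known m role hon M) : Known m role hon (mkSnd M) := by
  unfold EMV.mkSnd
  split
  · cases h with | pair h1 h2 => exact h2
  · exact .snd h

theorem of_enc {M K : Term} (h : Known m role hon (.enc M K)) :
    Known m role hon M ∧ (Known m role hon K ∨ hon M K) := by
  cases h with
  | enc h1 h2 => exact ⟨h1, .inl h2⟩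
  | honest h1 h2 => exact ⟨h1, .inr h2⟩

theorem mkDec {K M : Term} (hK : Known m role hon K) (hM : Known m role hon M) :
    Known m role hon (mkDec K M) := by
  unfold EMV.mkDec
  split
  · split_ifs
    · exact (of_enc hM).1
    · exact .dec hK hM
  · exact .dec hK hM

theorem of_sig {K M : Term} (h : Known m role hon (.sig K M)) :
    Known m role hon M ∧ (Known m role hon K ∨ K = .var 1 ∧ CardPoint m role hon M) := by
  cases h with
  | sig h1 h2 => exact ⟨h2, .inl h1⟩
  | cert h1 h2 h3 h4 =>
    have h : CardPoint m role hon M := ⟨h2, _, _, h1, h3, h4⟩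
    exact ⟨h.known, .inr ⟨rfl, h⟩⟩

theorem of_smult_sig {A K M : Term} (h : Known m role hon (.smult A (.sig K M))) :
    Known m role hon A ∧ Known m role hon (.sig K M) := by
  cases h with
  | smult h1 h2 => exact ⟨h1, h2⟩
  | point _ h => simp [base] at h

theorem mkCheck {V M : Term} (hV : Known m role hon V) (hM : Known m role hon M) :
    Known m role hon (mkCheck m V M) := by
  unfold EMV.mkCheck
  split
  · split_ifs
    · exact .checksig hV hM
    · exact (of_sig hM).1
    · exact .checksig hV hM
  · split_ifs
    · exact mkSmult (of_smult_sig hM).1 (of_sig (of_smult_sig hM).2).1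
    · exact .checksig hV hM
  · exact .checksig hV hM

/-- Whatever an attacker computes from a known frame is known. -/
theorem nf_subst {F : Subst} (hF : ∀ x, Known m role hon (nf m (F x))) (M : Term) :
    Known m role hon (nf m (M.subst F)) := by
  induction M with
  | var x => exact hF x
  | g => exact .g
  | auth => exact .auth
  | mult _ _ h1 h2 => exact h1.mkMult h2
  | smult _ _ h1 h2 => exact h1.mkSmult h2
  | pair _ _ h1 h2 => exact .pair h1 h2
  | hash _ h => exact .hash h
  | pks _ h => exact .pks h
  | sig _ _ h1 h2 => exact .sig h1 h2
  | enc _ _ h1 h2 => exact .enc h1 h2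
  | dec _ _ h1 h2 => exact h1.mkDec h2
  | checksig _ _ h1 h2 => exact h1.mkCheck h2
  | fst _ h => exact h.mkFst
  | snd _ h => exact h.mkSnd

/-! ### The checks of the terminal -/

/-- As the signing key is secret, a signature check with its public key only returns points of
cards, or it does not reduce. -/
theorem mkCheck_cases (hs : role 1 = .signing) {M : Term} (h : Known m role hon M) :
    CardPoint m role hon (EMV.mkCheck m (.pks (.var 1)) M) ∨
      EMV.mkCheck m (.pks (.var 1)) M = .checksig (.pks (.var 1)) M := by
  have hk : ∀ {N}, Known m role hon (.sig (.var 1) N) → CardPoint m role hon N := fun h =>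
    (of_sig h).2.elim (fun h => absurd h (not_var (by simp [hs]))) And.right
  unfold EMV.mkCheck
  split
  · rename_i heq
    cases heq
    split_ifs with h1 h2
    · exact .inr rfl
    · subst h2; exact .inl (hk h)
    · exact .inr rfl
  · rename_i heq
    cases heq
    split_ifs with h1
    · obtain ⟨-, -, rfl⟩ := h1
      exact .inl (CardPoint.mkSmult (of_smult_sig h).1 (hk (of_smult_sig h).2))
    · exact .inr rfl
  · exact .inr rfl

end Known

/-- The checks of the terminal, in terms of normal forms: `t` is the secret key of the terminal, and
`z₁`, `z₂` are the messages that it received. -/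
def Accepts (m : Mode) (t z₁ z₂ : Term) : Prop :=
  let D := mkDec (.hash (mkSmult m t z₁)) z₂
  if m.fixed then
    mkFst D = mkCheck m (.pks (.var 1)) (mkSnd D) ∧ mkFst D = z₁
  else
    mkSnd (mkFst D) = mkCheck m (.pks (.var 1)) (mkSnd (mkSnd D)) ∧
      mkSmult m (mkFst (mkFst D)) (mkSnd (mkFst D)) = z₁

/-- The terminal's session key is secret: if `z₁` is a multiple of a point that passes the
signature check, then the key contains both the secret of the terminal and the one of a card,
or the former in a point that is not over `g`. -/
theorem not_known_sessionKey {m : Mode} {role : ℕ → Role} {hon : Term → Term → Prop} {t : ℕ}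
    (hs : role 1 = .signing) (ht : role t = .terminal) {Z z : Term} (hZ : Known m role hon Z)
    (hz : z = mkCheck m (.pks (.var 1)) Z ∨
      ∃ A, Known m role hon A ∧ z = mkSmult m A (mkCheck m (.pks (.var 1)) Z)) :
    ¬ Known m role hon (mkSmult m (.var t) z) := fun hk => by
  have ht' : (role t).Secret := .inr ht
  have h : CardPoint m role hon z ∨
      (∃ V M, base z = .checksig V M) ∧ ∀ K M, z ≠ .sig K M := by
    rcases Known.mkCheck_cases hs hZ with h | h
    · rcases hz with rfl | ⟨A, hA, rfl⟩
      exacts [.inl h, .inl (h.mkSmult hA)]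
    · rw [h] at hz
      rcases hz with rfl | ⟨A, hA, rfl⟩
      · exact .inr ⟨⟨_, _, rfl⟩, by simp⟩
      · rw [mkSmult_checksig]; exact .inr ⟨⟨_, _, rfl⟩, by simp⟩
  rcases h with ⟨hb, x, S, hx, hs, -⟩ | ⟨⟨V, M, hb⟩, hn⟩
  · refine Known.not_two_secrets (x := t) (y := x) (S := S) ht' (.inl hx) ?_ hk
    rw [scal_mkSmult_of_base _ hb, hs]; simp only [factors, Multiset.singleton_add]
  · obtain ⟨h1, h2⟩ := scal_base_mkSmult (m := m) (.var t) (.inr (.inr hn))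
    rcases Known.scal_cases hk with ⟨-, h⟩ | ⟨h, -⟩
    · exact Known.not_secret ht' (h _ (by simp [h1, factors]))
    · rw [h2, hb] at h; cases h

/-- A message that the terminal accepts is a ciphertext with the terminal's session key that has
been sent by a card. -/
theorem Accepts.exists_honest {m : Mode} {role : ℕ → Role} {hon : Term → Term → Prop} {t : ℕ}
    (hs : role 1 = .signing) (ht : role t = .terminal) {z₁ z₂ : Term}
    (hz₂ : Known m role hon z₂) (h : Accepts m (.var t) z₁ z₂) :
    ∃ M, z₂ = .enc M (.hash (mkSmult m (.var t) z₁)) ∧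
      hon M (.hash (mkSmult m (.var t) z₁)) := by
  -- If decryption does not reduce, then the signature check cannot succeed either.
  have hstuck : mkDec (.hash (mkSmult m (.var t) z₁)) z₂ ≠
      .dec (.hash (mkSmult m (.var t) z₁)) z₂ := fun hD => by
    simp only [Accepts, hD] at h
    split_ifs at h
    · have := h.1
      simp [mkFst, mkSnd, mkCheck] at this
    · have := h.1
      simp [mkFst, mkSnd, mkCheck] at this
  unfold mkDec at hstuck
  split at hstuck
  · rename_i M K
    split_ifs at hstuck with hK
    · subst hK
      refine ⟨M, rfl, (Known.of_enc hz₂).2.resolve_left fun hk => ?_⟩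
      have hM := (Known.of_enc hz₂).1
      have hk : Known m role hon (mkSmult m (.var t) z₁) := by cases hk with | hash h => exact h
      simp only [Accepts, mkDec, if_true] at h
      split_ifs at h
      · exact not_known_sessionKey hs ht hM.mkSnd (.inl (h.2.symm.trans h.1)) hk
      · exact not_known_sessionKey hs ht hM.mkSnd.mkSnd
          (.inr ⟨_, hM.mkFst.mkFst, by rw [← h.1, h.2]⟩) hk
    · exact absurd rfl hstuck
  · exact absurd rfl hstuck

/-- The plaintext of the card's last message. -/
def plain (m : Mode) (s c a : Term) : Term :=
  let pkc : Term := .smult c .g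
  if m.fixed then .pair (.smult a pkc) (.smult a (.sig s pkc))
  else .pair (.pair a pkc) (.pair pkc (.sig s pkc))

/-- The symmetric key that the card computes. Both versions have the same normal form
in terms of `mkSmult`. -/
def key (m : Mode) : Term → Term → Term → Term :=
  if m.approx then approxCardKey else cardKey

theorem nf_key (m : Mode) (a c y : Term) :
    nf m (key m a c y) = .hash (mkSmult m (nf m a) (mkSmult m (nf m c) (nf m y))) := by
  by_cases ha : m.approx
  · simp [key, ha, approxCardKey, nf]
  · simp [key, ha, cardKey, nf, mkSmult, actSmult_mkMult]

/-- Cancellation of the scalars of a card. -/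
theorem eq_of_mkSmult_eq {m : Mode} {t a c : ℕ} {y : Term}
    (h : mkSmult m (.var t) (mkSmult m (.var a) (mkSmult m (.var c) .g)) =
      mkSmult m (.var a) (mkSmult m (.var c) y)) : y = .smult (.var t) .g := by
  have hg : base .g = .g := rfl
  have h1 := base_mkSmult_of_base m (.var c) hg
  have h2 := base_mkSmult_of_base m (.var a) h1
  have h3 := base_mkSmult_of_base m (.var t) h2
  have hs := congrArg (scal m) h
  rw [h] at h3
  have h4 := base_eq_of_mkSmult h3
  have h5 := base_eq_of_mkSmult h4
  rw [scal_mkSmult_of_base _ h2, scal_mkSmult_of_base _ h1, scal_mkSmult_of_base _ hg,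
    scal_mkSmult_of_base _ h4, scal_mkSmult_of_base _ h5] at hs
  refine eq_smult_g_of_scal (m := m) h5 ?_
  have hs' : factors m (.var a) + (factors m (.var c) + {Term.var t}) =
      factors m (.var a) + (factors m (.var c) + scal m y) := by
    rw [← hs]
    simp only [factors, scal, add_zero]
    rw [add_left_comm {Term.var t}, add_comm {Term.var t}]
  exact (add_left_cancel (add_left_cancel hs')).symm

/-- If the terminal accepts the ciphertext of a card, then the first message that the terminal
received is the card's blinded public key, and the card received the terminal's public key. -/
theorem Accepts.agree {m : Mode} {t c a : ℕ} {z₁ z₂ y : Term}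
    (hz₂ : z₂ = .enc (nf m (plain m (.var 1) (.var c) (.var a)))
      (.hash (mkSmult m (.var t) z₁)))
    (hk : .hash (mkSmult m (.var t) z₁) = nf m (key m (.var a) (.var c) y))
    (h : Accepts m (.var t) z₁ z₂) :
    z₁ = nf m (.smult (.var a) (.smult (.var c) .g)) ∧ nf m y = nf m (.smult (.var t) .g) := by
  -- The terminal reads off `z₁` from the plaintext.
  have hz₁ : z₁ = mkSmult m (.var a) (mkSmult m (.var c) .g) := by
    subst hz₂
    by_cases hf : m.fixed
    · simp only [Accepts, hf, mkDec, plain, if_true, mkFst] at h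
      exact h.2.symm
    · simp only [Accepts, hf, mkDec, plain, if_true, mkFst, mkSnd] at h
      exact h.2.symm
  refine ⟨hz₁, ?_⟩
  rw [nf_key, hz₁, Term.hash.injEq] at hk
  simp only [nf, mkSmult_g]
  exact eq_of_mkSmult_eq hk

/-! ### Substitutions -/

namespace Term

theorem subst_subst (M : Term) (σ τ : Subst) :
    (M.subst σ).subst τ = M.subst fun x => (σ x).subst τ := by
  induction M <;> simp_all [subst]

theorem subst_var (M : Term) : M.subst .var = M := by
  induction M <;> simp_all [subst]

theorem up_subst_lift (M : Term) (σ : Subst) : M.up.subst σ.lift = (M.subst σ).up := by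
  simp only [up, subst_subst]; rfl

theorem up_subst_inst (M N : Term) : M.up.subst (.inst N) = M := by
  simp only [up, subst_subst]
  exact M.subst_var

theorem subst_congr_of_fresh {M : Term} {u : ℕ} {σ τ : Subst} (h : M.Fresh u)
    (hστ : ∀ x, x ≠ u → σ x = τ x) : M.subst σ = M.subst τ := by
  induction M with
  | var x => exact hστ x (Ne.symm h)
  | _ => simp_all [Fresh, subst]

theorem Fresh.rename {M : Term} {u : ℕ} (h : M.Fresh u) {ρ : ℕ → ℕ}
    (hρ : Function.Injective ρ) : (M.subst fun x => var (ρ x)).Fresh (ρ u) := by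
  induction M with
  | var x => exact fun h' => h (hρ h')
  | _ => simp_all [Fresh, subst]

theorem fresh_up {M : Term} {u : ℕ} : M.up.Fresh (u + 1) ↔ M.Fresh u := by
  unfold up
  induction M with
  | var x => simp [Fresh, subst]
  | _ => simp_all [Fresh, subst]

end Term

theorem Subst.lift_subst_lift (σ τ : Subst) (x : ℕ) :
    (σ.lift x).subst τ.lift = Subst.lift (fun x => (σ x).subst τ) x := by
  cases x with
  | zero => rfl
  | succ x => exact Term.up_subst_lift _ _

theorem Subst.lift_rename (ρ : ℕ → ℕ) : Subst.lift (fun x => .var (ρ x)) =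
    fun x => .var (match x with | 0 => 0 | x + 1 => ρ x + 1) := by
  funext x; cases x <;> rfl

namespace Proc

theorem subst_subst (P : Proc) (σ τ : Subst) :
    (P.subst σ).subst τ = P.subst fun x => (σ x).subst τ := by
  induction P generalizing σ τ with
  | nil => rfl
  | _ => simp_all [subst, Term.subst_subst, Subst.lift_subst_lift]

theorem Fresh.rename {P : Proc} {u : ℕ} (h : P.Fresh u) {ρ : ℕ → ℕ}
    (hρ : Function.Injective ρ) : (P.subst fun x => .var (ρ x)).Fresh (ρ u) := by
  have hlift : ∀ {ρ : ℕ → ℕ}, Function.Injective ρ →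
      Function.Injective fun x : ℕ => (match x with | 0 => 0 | x + 1 => ρ x + 1 : ℕ) := by
    intro ρ hρ x y hxy
    cases x <;> cases y <;> simp_all
    exact hρ hxy
  induction P generalizing u ρ with
  | nil => trivial
  | send M N P ih => exact ⟨h.1.rename hρ, h.2.1.rename hρ, ih h.2.2 hρ⟩
  | recv M P ih =>
    refine ⟨h.1.rename hρ, ?_⟩
    rw [Subst.lift_rename]
    exact ih h.2 (hlift hρ)
  | nu P ih =>
    simp only [subst, Fresh, Subst.lift_rename]
    exact ih h (hlift hρ)
  | par P Q ihP ihQ => exact ⟨ihP h.1 hρ, ihQ h.2 hρ⟩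
  | rep P ih => exact ih h hρ
  | mat M N P ih => exact ⟨h.1.rename hρ, h.2.1.rename hρ, ih h.2.2 hρ⟩

end Proc

/-- The theories are closed under substitution. -/
theorem EqE.subst {m : Mode} {M N : Term} (h : EqE m.ax M N) (σ : Subst) :
    EqE m.ax (M.subst σ) (N.subst σ) := by
  induction h with
  | ax h =>
    refine .ax ?_
    have hS : ∀ {M N}, ScalarAx M N → ScalarAx (M.subst σ) (N.subst σ) := by
      rintro _ _ (_ | _ | _) <;> constructor
    have hDH : ∀ {M N}, DHAx M N → DHAx (M.subst σ) (N.subst σ) := by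
      rintro _ _ (_ | _) <;> constructor
    have hD : ∀ {M N}, DestructorAx M N → DestructorAx (M.subst σ) (N.subst σ) := by
      rintro _ _ (_ | _ | _) <;> constructor
    have hC : ∀ {M N}, CheckAx M N → CheckAx (M.subst σ) (N.subst σ) := by
      rintro _ _ ⟨_⟩; constructor
    have hB : ∀ {M N}, BlindAx M N → BlindAx (M.subst σ) (N.subst σ) := by
      rintro _ _ ⟨_⟩; constructor
    have hBC : ∀ {M N}, BlindCheckAx M N → BlindCheckAx (M.subst σ) (N.subst σ) := by
      rintro _ _ ⟨_⟩; constructor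
    obtain ⟨_ | _, _ | _⟩ := m
    · exact h.imp (Or.imp hS hD) hC
    · exact h.imp (Or.imp (Or.imp hS hD) hC) hB
    · exact h.imp (Or.imp hDH hD) hC
    · exact h.imp (Or.imp hDH hD) hBC
  | refl => exact .refl _
  | symm _ ih => exact ih.symm
  | trans _ _ ih1 ih2 => exact ih1.trans ih2
  | mult _ _ h1 h2 => exact h1.mult h2
  | smult _ _ h1 h2 => exact h1.smult h2
  | pair _ _ h1 h2 => exact h1.pair h2
  | hash _ h => exact h.hash
  | pks _ h => exact h.pks
  | sig _ _ h1 h2 => exact h1.sig h2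
  | enc _ _ h1 h2 => exact h1.enc h2
  | dec _ _ h1 h2 => exact h1.dec h2
  | checksig _ _ h1 h2 => exact h1.checksig h2
  | fst _ h => exact h.fst
  | snd _ h => exact h.snd

/-! ### Transitions with global names -/

/-- The global name of the variable `x` underneath `n` restrictions: the free variable `x` has the
name `2 * x`, and the private name of the `n`-th restriction, counted from the outside, is
`2 * n + 1`. -/
def globalName : ℕ → ℕ → ℕ
  | 0, x => 2 * x
  | n + 1, 0 => 2 * n + 1
  | n + 1, x + 1 => globalName n x

/-- The renaming of the variables underneath `n` restrictions to their global names. -/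
def global (n : ℕ) : Subst := fun x => .var (globalName n x)

theorem globalName_add (n x : ℕ) : globalName n (x + n) = 2 * x := by
  induction n with
  | zero => rfl
  | succ n ih => exact ih

/-- Odd names are private. -/
theorem globalName_lt (n x : ℕ) : globalName n x % 2 = 1 → globalName n x < 2 * n := by
  induction n generalizing x with
  | zero => simp [globalName]
  | succ n ih =>
    cases x with
    | zero => simp only [globalName]; omega
    | succ x => simp only [globalName]; have := ih x; omega

theorem globalName_injective (n : ℕ) : Function.Injective (globalName n) := by
  induction n with
  | zero => intro x y h; simp only [globalName] at h; omega
  | succ n ih =>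
    intro x y h
    cases x <;> cases y <;> simp only [globalName] at h ⊢
    · rename_i y; have := globalName_lt n y; omega
    · rename_i x; have := globalName_lt n x; omega
    · rw [ih h]

namespace Label

/-- The same label, seen from underneath `n` more binders. -/
def shift (n : ℕ) : Label → Label
  | tau => tau
  | out M u => out (M.subst fun x => .var (x + n)) (u + n)
  | inp M N => inp (M.subst fun x => .var (x + n)) (N.subst fun x => .var (x + n))

theorem shift_zero (l : Label) : l.shift 0 = l := by
  cases l <;> simp only [shift, add_zero, Term.subst_var]

theorem up_shift (n : ℕ) (l : Label) : (l.shift n).up = l.shift (n + 1) := by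
  cases l <;> simp only [shift, up, Term.up, Term.subst_subst] <;> rfl

/-- The bound name of the label, if any, does not occur free in `Q`, which is written with global
names. -/
def FreshIn : Label → Proc → Prop
  | out _ u, Q => Q.Fresh (2 * u)
  | _, _ => True

end Label

/-- Transitions of processes with global names. A state consists of a frame `F`, which maps the
free variables to messages with global names, the number `n` of private names that have been
generated, and a process with global names. -/
inductive FlatStep (Ax : Axioms) : Subst → ℕ → Proc → Label → Subst → ℕ → Proc → Prop
  | inp {F n K P M N} :
      EqE Ax (M.subst F) K →
      FlatStep Ax F n (.recv K P) (.inp M N) F n (P.subst (.inst (N.subst F)))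
  | out {F n K N P M u} :
      EqE Ax (M.subst F) K → N.Fresh (2 * u) → P.Fresh (2 * u) → F u = .var (2 * u) →
      (∀ x, x ≠ u → (F x).Fresh (2 * u)) →
      FlatStep Ax F n (.send K N P) (.out M u) (Function.update F u N) n P
  | mat {F n M N P l F' n' P'} :
      FlatStep Ax F n P l F' n' P' → EqE Ax M N → FlatStep Ax F n (.mat M N P) l F' n' P'
  | nu {F n P l F' n' P'} :
      FlatStep Ax F (n + 1) (P.subst (.inst (.var (2 * n + 1)))) l F' n' P' →
      FlatStep Ax F n (.nu P) l F' n' P'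
  | rep {F n P l F' n' P'} :
      FlatStep Ax F n P l F' n' P' → l.FreshIn P →
      FlatStep Ax F n (.rep P) l F' n' (.par P' (.rep P))
  | parL {F n P Q l F' n' P'} :
      FlatStep Ax F n P l F' n' P' → l.FreshIn Q →
      FlatStep Ax F n (.par P Q) l F' n' (.par P' Q)
  | parR {F n P Q l F' n' P'} :
      FlatStep Ax F n P l F' n' P' → l.FreshIn Q →
      FlatStep Ax F n (.par Q P) l F' n' (.par Q P')

/-- `Flat n A F n' P`: underneath `n` restrictions, the extended process `A` is described with
global names by the frame `F`, the number `n'` of private names, and the process `P`. -/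
def Flat : ℕ → Ext → Subst → ℕ → Proc → Prop
  | n, .base σ P, F, n', Q =>
    n' = n ∧ (∀ x < n, σ x = .var x) ∧ (∀ x, (σ (x + n)).subst (global n) = F x) ∧
      Q = P.subst (global n)
  | n, .nu A, F, n', Q => Flat (n + 1) A F n' Q

theorem Proc.up_subst_global (n : ℕ) (P : Proc) :
    P.up.subst (global (n + 1)) = P.subst (global n) :=
  P.subst_subst _ _

theorem Term.up_subst_global (n : ℕ) (M : Term) :
    M.up.subst (global (n + 1)) = M.subst (global n) :=
  M.subst_subst _ _

theorem Flat.parRight {n : ℕ} {A : Ext} {F : Subst} {n' : ℕ} {P : Proc} (h : Flat n A F n' P)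
    (Q : Proc) : Flat n (A.parRight Q) F n' (.par P (Q.subst (global n))) := by
  induction A generalizing n Q with
  | base σ R => obtain ⟨h1, h2, h3, rfl⟩ := h; exact ⟨h1, h2, h3, rfl⟩
  | nu A ih => rw [← Q.up_subst_global]; exact ih h Q.up

theorem Flat.parLeft {n : ℕ} {A : Ext} {F : Subst} {n' : ℕ} {P : Proc} (h : Flat n A F n' P)
    (Q : Proc) : Flat n (.parLeft Q A) F n' (.par (Q.subst (global n)) P) := by
  induction A generalizing n Q with
  | base σ R => obtain ⟨h1, h2, h3, rfl⟩ := h; exact ⟨h1, h2, h3, rfl⟩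
  | nu A ih => rw [← Q.up_subst_global]; exact ih h Q.up

/-- Recipes are evaluated in the same way with global names. -/
theorem subst_shift_subst {n : ℕ} {σ F : Subst} (h : ∀ x, (σ (x + n)).subst (global n) = F x)
    (M : Term) : ((M.subst fun x => .var (x + n)).subst σ).subst (global n) = M.subst F := by
  simp only [Term.subst_subst]
  congr 1
  funext x
  exact h x

theorem Term.Fresh.subst_global {M : Term} {u n : ℕ} (h : M.Fresh (u + n)) :
    (M.subst (global n)).Fresh (2 * u) :=
  globalName_add n u ▸ h.rename (globalName_injective n)

theorem Proc.Fresh.subst_global {P : Proc} {u n : ℕ} (h : P.Fresh (u + n)) :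
    (P.subst (global n)).Fresh (2 * u) :=
  globalName_add n u ▸ h.rename (globalName_injective n)

theorem Label.BnFresh.freshIn {n : ℕ} {l : Label} {Q : Proc} (h : (l.shift n).BnFresh Q) :
    l.FreshIn (Q.subst (global n)) := by
  cases l with
  | out M u => exact Proc.Fresh.subst_global h
  | _ => trivial

/-- Every transition is a transition with global names. -/
theorem Step.flat {m : Mode} {A B : Ext} {l' : Label} (h : Step m.ax A l' B) {n : ℕ} {l : Label}
    (hl : l' = l.shift n) {F : Subst} {k : ℕ} {P : Proc} (hA : Flat n A F k P) :
    ∃ F' k' P', FlatStep m.ax F k P l F' k' P' ∧ Flat n B F' k' P' := by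
  induction h generalizing n l F k P with
  | @inp σ K R M N h =>
    obtain ⟨rfl, h1, h2, rfl⟩ := hA
    cases l with
    | inp M N =>
      cases hl
      refine ⟨_, _, _, .inp ?_, rfl, h1, h2, ?_⟩
      · rw [← subst_shift_subst h2]; exact h.subst _
      · rw [← subst_shift_subst h2]
        simp only [Proc.subst_subst]
        congr 1
        funext x
        cases x with
        | zero => rfl
        | succ x => exact (Term.up_subst_inst (global k x)
            (((N.subst fun x => .var (x + k)).subst σ).subst (global k))).symm
    | _ => cases hl
  | @out σ K N R M u h hM hN hP hσ =>
    obtain ⟨rfl, h1, h2, rfl⟩ := hA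
    cases l with
    | out M u =>
      cases hl
      refine ⟨_, _, _, .out ?_ hN.subst_global hP.subst_global ?_ ?_, rfl, ?_, ?_, rfl⟩
      · rw [← subst_shift_subst h2]; exact h.subst _
      · rw [← h2, hσ.1]; simp [Term.subst, global, globalName_add]
      · intro x hx
        rw [← h2]
        exact (hσ.2 _ (by omega)).subst_global
      · intro x hx
        rw [Function.update_of_ne (by omega), h1 x hx]
      · intro x
        by_cases hx : x = u
        · subst hx; simp
        · rw [Function.update_of_ne (by omega), Function.update_of_ne hx, h2]
    | _ => cases hl
  | mat _ h ih =>
    obtain ⟨rfl, h1, h2, rfl⟩ := hA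
    obtain ⟨F', k', P', h3, h4⟩ := ih hl ⟨rfl, h1, h2, rfl⟩
    exact ⟨F', k', P', .mat h3 (h.subst _), h4⟩
  | res _ ih => exact ih (hl ▸ l.up_shift n) hA
  | @extrusion σ Q _ B _ ih =>
    obtain ⟨rfl, h1, h2, rfl⟩ := hA
    have hQ : (Q.subst (global k).lift).subst (.inst (.var (2 * k + 1))) =
        Q.subst (global (k + 1)) := by
      rw [Proc.subst_subst]
      congr 1
      funext x
      cases x with
      | zero => rfl
      | succ x => exact Term.up_subst_inst _ _
    have hB : Flat (k + 1) (.base σ.lift Q) F (k + 1) (Q.subst (global (k + 1))) := by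
      refine ⟨rfl, fun x hx => ?_, fun x => (Term.up_subst_global _ _).trans (h2 x), rfl⟩
      cases x with
      | zero => rfl
      | succ x =>
        change (σ x).up = _
        rw [h1 x (by omega)]
        rfl
    obtain ⟨F', k', P', h3, h4⟩ := ih (hl ▸ l.up_shift k) hB
    exact ⟨F', k', P', .nu (hQ ▸ h3), h4⟩
  | rep _ h ih =>
    obtain ⟨rfl, h1, h2, rfl⟩ := hA
    obtain ⟨F', k', P', h3, h4⟩ := ih hl ⟨rfl, h1, h2, rfl⟩
    subst hl
    exact ⟨F', k', _, .rep h3 h.freshIn, h4.parRight _⟩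
  | parL _ h ih =>
    obtain ⟨rfl, h1, h2, rfl⟩ := hA
    obtain ⟨F', k', P', h3, h4⟩ := ih hl ⟨rfl, h1, h2, rfl⟩
    subst hl
    exact ⟨F', k', _, .parL h3 h.freshIn, h4.parRight _⟩
  | parR _ h ih =>
    obtain ⟨rfl, h1, h2, rfl⟩ := hA
    obtain ⟨F', k', P', h3, h4⟩ := ih hl ⟨rfl, h1, h2, rfl⟩
    subst hl
    exact ⟨F', k', _, .parR h3 h.freshIn, h4.parLeft _⟩

/-- Renaming to global names reflects equality of messages. -/
theorem eqE_subst_global {m : Mode} {n : ℕ} {M N : Term} :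
    EqE m.ax (M.subst (global n)) (N.subst (global n)) ↔ EqE m.ax M N := by
  refine ⟨fun h => ?_, fun h => h.subst _⟩
  have key : ∀ M : Term, (M.subst (global n)).subst
      (fun x => .var (Function.invFun (globalName n) x)) = M := fun M => by
    rw [Term.subst_subst]
    conv_rhs => rw [← M.subst_var]
    congr 1
    funext x
    exact congrArg Term.var (Function.leftInverse_invFun (globalName_injective n) x)
  have := h.subst fun x => .var (Function.invFun (globalName n) x)
  rwa [key, key] at this

/-- Recipes are equal in an extended process iff their values with global names are. -/
theorem Flat.sat_iff {m : Mode} {A : Ext} {n : ℕ} {F : Subst} {k : ℕ} {P : Proc}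
    (h : Flat n A F k P) (M N : Term) :
    A.Sat m.ax (M.subst fun x => .var (x + n)) (N.subst fun x => .var (x + n)) ↔
      EqE m.ax (M.subst F) (N.subst F) := by
  induction A generalizing n with
  | base σ Q =>
    obtain ⟨-, -, h2, -⟩ := h
    rw [← subst_shift_subst h2, ← subst_shift_subst h2, eqE_subst_global]; rfl
  | nu A ih =>
    rw [← ih h]
    simp only [Ext.Sat, Term.up, Term.subst_subst]; rfl

/-! ### Parallel components -/

/-- The multiset of parallel components of a process. -/
def parts : Proc → Multiset Proc
  | .par P Q => parts P + parts Q
  | P => {P}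

theorem Label.FreshIn.of_mem_parts {l : Label} {P Q : Proc} (h : l.FreshIn P) (hQ : Q ∈ parts P) :
    l.FreshIn Q := by
  cases l with
  | out M u =>
    induction P with
    | par P P' ih ih' =>
      exact (Multiset.mem_add.1 hQ).elim (fun hQ => ih hQ h.1) fun hQ => ih' hQ h.2
    | _ => rw [Multiset.mem_singleton.1 hQ]; exact h
  | _ => trivial

/-- Every transition is a transition of a single parallel component. -/
theorem FlatStep.exists_part {Ax : Axioms} {F : Subst} {n : ℕ} {P : Proc} {l : Label} {F' : Subst}
    {n' : ℕ} {P' : Proc} (h : FlatStep Ax F n P l F' n' P') :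
    ∃ p R p', parts P = p ::ₘ R ∧ FlatStep Ax F n p l F' n' p' ∧ parts P' = parts p' + R ∧
      ∀ q ∈ R, l.FreshIn q := by
  have leaf : ∀ {F n P l F' n' P'}, parts P = {P} → FlatStep Ax F n P l F' n' P' →
      ∃ p R p', parts P = p ::ₘ R ∧ FlatStep Ax F n p l F' n' p' ∧ parts P' = parts p' + R ∧
      ∀ q ∈ R, l.FreshIn q :=
    fun hP h => ⟨_, 0, _, hP, h, (add_zero _).symm, by simp⟩
  induction h with
  | @parL _ _ Q _ _ _ _ _ h ih =>
    obtain ⟨p, R, p', h1, h2, h3, h4⟩ := ih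
    refine ⟨p, R + parts Q, p', ?_, h2, ?_, fun q hq => ?_⟩
    · simp [parts, h1]
    · simp [parts, h3, add_assoc]
    · exact (Multiset.mem_add.1 hq).elim (h4 q) h.of_mem_parts
  | @parR _ _ Q _ _ _ _ _ h ih =>
    obtain ⟨p, R, p', h1, h2, h3, h4⟩ := ih
    refine ⟨p, parts Q + R, p', ?_, h2, ?_, fun q hq => ?_⟩
    · simp [parts, h1]
    · simp [parts, h3, add_left_comm]
    · exact (Multiset.mem_add.1 hq).elim h.of_mem_parts (h4 q)
  | inp h => exact leaf rfl (.inp h)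
  | out h1 h2 h3 h4 h5 => exact leaf rfl (.out h1 h2 h3 h4 h5)
  | mat h1 h2 => exact leaf rfl (.mat h1 h2)
  | nu h => exact leaf rfl (.nu h)
  | rep h1 h2 => exact leaf rfl (.rep h1 h2)

/-! ### The sessions of the protocols -/

/-- The card of a mode. -/
def card (m : Mode) (s c ch : Term) : Proc :=
  .nu <| .send ch.up (.smult (.var 0) (.smult c.up .g)) <| .recv ch.up <|
    .send ch.up.up (.enc (plain m s.up.up c.up.up (.var 1)) (key m (.var 1) c.up.up (.var 0))) .nil

/-- The card after its first output, with the blinding factor `a`. -/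
def cardAfterSend (m : Mode) (s c ch a : Term) : Proc :=
  .recv ch <| .send ch.up (.enc (plain m s.up c.up a.up) (key m a.up c.up (.var 0))) .nil

/-- The card after it received `y`. -/
def cardAfterRecv (m : Mode) (s c ch a y : Term) : Proc :=
  .send ch (.enc (plain m s c a) (key m a c y)) .nil

/-- The checks of the terminal. -/
def verify (m : Mode) (s t z₁ z₂ : Term) (P : Proc) : Proc :=
  let kt : Term := .hash (.smult t z₁)
  let m₁ : Term := .fst (.dec kt z₂)
  let m₂ : Term := .snd (.dec kt z₂)
  if m.fixed then .mat m₁ (.checksig (.pks s) m₂) <| .mat m₁ z₁ P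
  else .mat (.snd m₁) (.checksig (.pks s) (.snd m₂)) <| .mat (.smult (.fst m₁) (.snd m₁)) z₁ P

/-- The terminal of a mode. -/
def terminal (m : Mode) (s ch : Term) : Proc :=
  .nu <| .recv ch.up <| .send ch.up.up (.smult (.var 1) .g) <| .recv ch.up.up <|
    verify m s.up.up.up (.var 2) (.var 1) (.var 0) <| .send ch.up.up.up .auth .nil

/-- The terminal with the secret key `t` after it received `z₁` and sent its public key. -/
def terminalAfterSend (m : Mode) (s ch t z₁ : Term) : Proc :=
  .recv ch <| verify m s.up t.up z₁.up (.var 0) <| .send ch.up .auth .nil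

/-- The terminal with the secret key `t` after it received `z₁`. -/
def terminalAfterRecv (m : Mode) (s ch t z₁ : Term) : Proc :=
  .send ch (.smult t .g) <| terminalAfterSend m s ch t z₁

/-- All sessions of the card with secret key `c`. -/
def cardSessions (m : Mode) (s c : Term) : Proc :=
  .rep <| .nu <| .send (.var 3) (.var 0) <| card m s.up c.up (.var 0)

/-- All cards. -/
def cards (m : Mode) (s : Term) : Proc :=
  .rep <| .nu <| .rep <| .nu <| .send (.var 4) (.var 0) <| card m s.up.up (.var 1) (.var 0)

/-- All terminal sessions. -/
def terminals (m : Mode) (s : Term) : Proc :=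
  .rep <| .nu <| .send (.var 5) (.var 0) <| terminal m s.up (.var 0)

theorem plain_subst (m : Mode) (s c a : Term) (σ : Subst) :
    (plain m s c a).subst σ = plain m (s.subst σ) (c.subst σ) (a.subst σ) := by
  unfold plain; split <;> rfl

theorem key_subst (m : Mode) (a c y : Term) (σ : Subst) :
    (key m a c y).subst σ = key m (a.subst σ) (c.subst σ) (y.subst σ) := by
  unfold key; split <;> rfl

theorem verify_subst (m : Mode) (s t z₁ z₂ : Term) (P : Proc) (σ : Subst) :
    (verify m s t z₁ z₂ P).subst σ =
      verify m (s.subst σ) (t.subst σ) (z₁.subst σ) (z₂.subst σ) (P.subst σ) := by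
  unfold verify; split <;> rfl

theorem card_subst (m : Mode) (s c ch : Term) (σ : Subst) :
    (card m s c ch).subst σ = card m (s.subst σ) (c.subst σ) (ch.subst σ) := by
  simp [card, Proc.subst, Term.subst, Term.up_subst_lift, plain_subst, key_subst, Subst.lift]
  exact ⟨rfl, rfl⟩

theorem terminal_subst (m : Mode) (s ch : Term) (σ : Subst) :
    (terminal m s ch).subst σ = terminal m (s.subst σ) (ch.subst σ) := by
  simp [terminal, Proc.subst, Term.subst, Term.up_subst_lift, verify_subst, Subst.lift]
  exact ⟨rfl, rfl⟩

/-- A parallel component of a reachable state, together with the part of its past that matters. The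
private name `1` is the signing key. A session of a card is identified by the position `p` of the
announcement of its channel `ch`, and the variable `v` holds the announced channel; a session of a
terminal is identified by its secret key `t`. -/
inductive Session : Type
  | cards
  | cardSessions (c : ℕ)
  | card (p v c ch : ℕ)
  | cardAfterSend (p v c ch a : ℕ)
  /-- The card has received the recipe `M`, whose value is `y`. -/
  | cardAfterRecv (p v c ch a : ℕ) (M y : Term)
  /-- The ciphertext has been sent as `uk` at position `k`. -/
  | cardDone (p v c ch a : ℕ) (M y : Term) (k uk : ℕ)
  | issuer
  | terminals
  | terminal (ch : ℕ)
  /-- The terminal has received the recipe `M₁`, whose value is `z₁`. -/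
  | terminalAfterRecv (ch t : ℕ) (M₁ z₁ : Term)
  | terminalAfterSend (ch t : ℕ) (M₁ z₁ : Term)
  /-- The terminal has received, moreover, the recipe `M₂`, whose value is `z₂`. -/
  | verify (ch t : ℕ) (M₁ z₁ M₂ z₂ : Term)
  /-- The terminal has signalled success at position `pos`. -/
  | terminalDone (ch t pos : ℕ)

namespace Session

/-- The process that a session still has to execute. -/
def proc (m : Mode) : Session → Proc
  | cards => EMV.cards m (.var 1)
  | cardSessions c => EMV.cardSessions m (.var 1) (.var c)
  | card _ _ c ch => EMV.card m (.var 1) (.var c) (.var ch)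
  | cardAfterSend _ _ c ch a => EMV.cardAfterSend m (.var 1) (.var c) (.var ch) (.var a)
  | cardAfterRecv _ _ c ch a _ y => EMV.cardAfterRecv m (.var 1) (.var c) (.var ch) (.var a) y
  | cardDone .. => .nil
  | issuer => .send (.var 0) (.pks (.var 1)) (EMV.terminals m (.var 1))
  | terminals => EMV.terminals m (.var 1)
  | terminal ch => EMV.terminal m (.var 1) (.var ch)
  | terminalAfterRecv ch t _ z₁ => EMV.terminalAfterRecv m (.var 1) (.var ch) (.var t) z₁
  | terminalAfterSend ch t _ z₁ => EMV.terminalAfterSend m (.var 1) (.var ch) (.var t) z₁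
  | verify ch t _ z₁ _ z₂ => EMV.verify m (.var 1) (.var t) z₁ z₂ (.send (.var ch) .auth .nil)
  | terminalDone .. => .nil

/-- The identifier of a card session: the position of the announcement of its channel. -/
def cardId : Session → Option ℕ
  | card p _ _ _ => some p
  | cardAfterSend p _ _ _ _ => some p
  | cardAfterRecv p _ _ _ _ _ _ => some p
  | cardDone p _ _ _ _ _ _ _ _ => some p
  | _ => none

/-- The identifier of a terminal session: its secret key, once it has been generated. -/
def terminalId : Session → Option ℕ
  | terminalAfterRecv _ t _ _ => some t
  | terminalAfterSend _ t _ _ => some t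
  | verify _ t _ _ _ _ => some t
  | terminalDone _ t _ => some t
  | _ => none

end Session

/-! ### The past of a session -/

/-- The action at position `i` is the output of `u` on the channel with the global name `ch`. -/
def Sent (m : Mode) (ls : List Label) (F : Subst) (i ch u : ℕ) : Prop :=
  ∃ M, ls[i]? = some (.out M u) ∧ EqE m.ax (M.subst F) (.var ch)

/-- The action at position `i` is the input of `N` on the channel with the global name `ch`. -/
def Received (m : Mode) (ls : List Label) (F : Subst) (i ch : ℕ) (N : Term) : Prop :=
  ∃ M, ls[i]? = some (.inp M N) ∧ EqE m.ax (M.subst F) (.var ch)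

/-- A private name that is used as a session channel. -/
def IsChannel (role : ℕ → Role) (ch : ℕ) : Prop := role ch = .pub ∧ ch % 2 = 1

/-- The card session `p` has announced its channel. -/
def Announced (m : Mode) (role : ℕ → Role) (ls : List Label) (F : Subst) (p v c ch : ℕ) : Prop :=
  role c = .card ∧ IsChannel role ch ∧ Sent m ls F p (2 * cardName) v ∧ F v = .var ch

/-- The card session `p` has sent its blinded public key at position `i`. -/
def Blinded (m : Mode) (role : ℕ → Role) (ls : List Label) (F : Subst) (p v c ch a i u : ℕ) :
    Prop :=
  Announced m role ls F p v c ch ∧ role a = .pub ∧ p < i ∧ Sent m ls F i ch u ∧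
    F u = .smult (.var a) (.smult (.var c) .g)

/-- The terminal session `t` has received `M₁` at position `i`. -/
def Started (m : Mode) (role : ℕ → Role) (ls : List Label) (F : Subst) (ch t i : ℕ)
    (M₁ : Term) : Prop :=
  IsChannel role ch ∧ role t = .terminal ∧ Received m ls F i ch M₁

/-- The terminal session `t` has, moreover, sent its public key at position `j`. -/
def Replied (m : Mode) (role : ℕ → Role) (ls : List Label) (F : Subst) (ch t i j u : ℕ)
    (M₁ : Term) : Prop :=
  Started m role ls F ch t i M₁ ∧ i < j ∧ Sent m ls F j ch u ∧ F u = .smult (.var t) .g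

/-- The card session `p` has, moreover, received `M`, whose value is `y`, at position `j`, and it
has sent its ciphertext at position `k`. -/
def Finished (m : Mode) (role : ℕ → Role) (ls : List Label) (F : Subst) (p v c ch a : ℕ)
    (M y : Term) (i j k u uk : ℕ) : Prop :=
  M.subst F = y ∧ Blinded m role ls F p v c ch a i u ∧ i < j ∧ Received m ls F j ch M ∧ j < k ∧
    Sent m ls F k ch uk ∧
    F uk = .enc (plain m (.var 1) (.var c) (.var a)) (key m (.var a) (.var c) y)

/-- What is known about the past of a session. -/
def Session.Ok (m : Mode) (role : ℕ → Role) (ls : List Label) (F : Subst) : Session → Prop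
  | cards => True
  | cardSessions c => role c = .card
  | card p v c ch => Announced m role ls F p v c ch
  | cardAfterSend p v c ch a => ∃ i u, Blinded m role ls F p v c ch a i u
  | cardAfterRecv p v c ch a M y =>
    M.subst F = y ∧ ∃ i j u, Blinded m role ls F p v c ch a i u ∧ i < j ∧ Received m ls F j ch M
  | cardDone p v c ch a M y k uk => ∃ i j u, Finished m role ls F p v c ch a M y i j k u uk
  | issuer => True
  | terminals => True
  | terminal ch => IsChannel role ch
  | terminalAfterRecv ch t M₁ z₁ => M₁.subst F = z₁ ∧ ∃ i, Started m role ls F ch t i M₁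
  | terminalAfterSend ch t M₁ z₁ => M₁.subst F = z₁ ∧ ∃ i j u, Replied m role ls F ch t i j u M₁
  | verify ch t M₁ z₁ M₂ z₂ => M₁.subst F = z₁ ∧ M₂.subst F = z₂ ∧
      ∃ i j u k, Replied m role ls F ch t i j u M₁ ∧ j < k ∧ Received m ls F k ch M₂
  | terminalDone ch t pos => IsChannel role ch ∧ role t = .terminal ∧ ∃ u, Sent m ls F pos ch u

/-- The terminal session `t`, which succeeded at position `pos`, agrees with the finished card
session `p`. -/
def Agrees (m : Mode) (role : ℕ → Role) (ls : List Label) (F : Subst) (L : Multiset Session)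
    (ch t pos p : ℕ) : Prop :=
  ∃ v c ch' a M y i' j' k' u' uk, .cardDone p v c ch' a M y k' uk ∈ L ∧ k' < pos ∧
    Finished m role ls F p v c ch' a M y i' j' k' u' uk ∧
    ∃ i j u k M₁ M₂, Replied m role ls F ch t i j u M₁ ∧ j < k ∧ Received m ls F k ch M₂ ∧
      k < pos ∧
      EqE m.ax ((Term.var u').subst F) (M₁.subst F) ∧
      EqE m.ax ((Term.var u).subst F) (M.subst F) ∧
      EqE m.ax ((Term.var uk).subst F) (M₂.subst F)

/-! ### Growth of the frame -/

/-- The bound name of the label, if any, does not occur in `M`, which is written with global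
names. -/
def Label.FreshInTerm : Label → Term → Prop
  | out _ u, M => M.Fresh (2 * u)
  | _, _ => True

/-- The variable `u` is new for the frame `F`. -/
def New (F : Subst) (u : ℕ) : Prop := F u = .var (2 * u) ∧ ∀ x, x ≠ u → (F x).Fresh (2 * u)

/-- The frame `F` becomes `F'` by a transition with the given label. The name `card` remains free,
as there are always further cards. -/
def Grows (F : Subst) : Label → Subst → Prop
  | .out _ u, F' => u ≠ cardName ∧ New F u ∧ ∃ N, F' = Function.update F u N
  | _, F' => F' = F

namespace Grows

variable {m : Mode} {F F' : Subst} {l : Label}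

/-- Growth of the frame is a substitution `τ` of its values, as the new variable may occur in
recipes used before. It affects neither messages without the new variable nor private names. -/
theorem exists_subst (h : Grows F l F') :
    ∃ τ : Subst, (∀ M : Term, M.subst F' = (M.subst F).subst τ) ∧
    (∀ M, l.FreshInTerm M → M.subst τ = M) ∧ ∀ x, x % 2 = 1 ∨ x = 2 * cardName → τ x = .var x := by
  cases l with
  | out K u =>
    obtain ⟨hu, ⟨h1, h2⟩, N, rfl⟩ := h
    have hτ : ∀ M : Term, M.Fresh (2 * u) →
        M.subst (Function.update .var (2 * u) N) = M := fun M hM => by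
      conv_rhs => rw [← M.subst_var]
      exact Term.subst_congr_of_fresh hM fun x hx => Function.update_of_ne hx _ _
    refine ⟨Function.update .var (2 * u) N, fun M => ?_, hτ, fun x hx => ?_⟩
    · rw [Term.subst_subst]
      congr 1
      funext x
      by_cases hx : x = u
      · subst hx; simp [h1, Term.subst]
      · rw [Function.update_of_ne hx, hτ _ (h2 x hx)]
    · exact Function.update_of_ne (by omega) _ _
  | _ =>
    cases h
    exact ⟨.var, fun M => (Term.subst_var _).symm, fun M _ => Term.subst_var _, fun _ _ => rfl⟩

theorem eqE (h : Grows F l F') {M N : Term} (hMN : EqE m.ax (M.subst F) (N.subst F)) :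
    EqE m.ax (M.subst F') (N.subst F') := by
  obtain ⟨τ, h1, -, -⟩ := h.exists_subst
  rw [h1, h1]; exact hMN.subst τ

theorem eqE_var (h : Grows F l F') {M : Term} {x : ℕ} (hx : x % 2 = 1 ∨ x = 2 * cardName)
    (hM : EqE m.ax (M.subst F) (.var x)) : EqE m.ax (M.subst F') (.var x) := by
  obtain ⟨τ, h1, -, h2⟩ := h.exists_subst
  have := hM.subst τ
  rw [← h1] at this
  rwa [Term.subst, h2 x hx] at this

theorem subst_eq (h : Grows F l F') {M y : Term} (hy : l.FreshInTerm y) (hM : M.subst F = y) :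
    M.subst F' = y := by
  obtain ⟨τ, h1, h2, -⟩ := h.exists_subst
  rw [h1, hM, h2 y hy]

theorem apply_eq (h : Grows F l F') {x : ℕ} {N : Term} (hx : F x = N) (hN : N ≠ .var (2 * x)) :
    F' x = N := by
  cases l with
  | out K u =>
    obtain ⟨-, ⟨h1, -⟩, N, rfl⟩ := h
    rw [Function.update_of_ne, hx]
    rintro rfl
    exact hN (hx ▸ h1)
  | _ => cases h; exact hx

theorem freshInTerm (h : Grows F l F') {x : ℕ} (hx : F x ≠ .var (2 * x)) :
    l.FreshInTerm (F x) := by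
  cases l with
  | out K u =>
    obtain ⟨-, ⟨h1, h2⟩, -⟩ := h
    refine h2 x ?_
    rintro rfl
    exact hx h1
  | _ => trivial

end Grows

theorem getElem?_append_of_eq_some {α : Type*} {ls : List α} {i : ℕ} {x : α}
    (h : ls[i]? = some x) (l : List α) : (ls ++ l)[i]? = some x := by
  rw [List.getElem?_append_left (List.getElem?_eq_some_iff.1 h).1, h]

section Mono

variable {m : Mode} {role role' : ℕ → Role} {ls : List Label} {F F' : Subst} {l : Label}

theorem Sent.mono (hF : Grows F l F') {i ch u : ℕ} (hch : ch % 2 = 1 ∨ ch = 2 * cardName)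
    (h : Sent m ls F i ch u) : Sent m (ls ++ [l]) F' i ch u := by
  obtain ⟨M, h1, h2⟩ := h
  exact ⟨M, getElem?_append_of_eq_some h1 _, hF.eqE_var hch h2⟩

theorem Received.mono (hF : Grows F l F') {i ch : ℕ} {N : Term}
    (hch : ch % 2 = 1 ∨ ch = 2 * cardName) (h : Received m ls F i ch N) :
    Received m (ls ++ [l]) F' i ch N := by
  obtain ⟨M, h1, h2⟩ := h
  exact ⟨M, getElem?_append_of_eq_some h1 _, hF.eqE_var hch h2⟩

theorem IsChannel.mono (hr : ∀ x, role x ≠ .unused → role' x = role x) {ch : ℕ}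
    (h : IsChannel role ch) : IsChannel role' ch :=
  ⟨by rw [hr ch (by simp [h.1]), h.1], h.2⟩

theorem Announced.mono (hF : Grows F l F') (hr : ∀ x, role x ≠ .unused → role' x = role x)
    {p v c ch : ℕ} (h : Announced m role ls F p v c ch) :
    Announced m role' (ls ++ [l]) F' p v c ch := by
  obtain ⟨h1, h2, h3, h4⟩ := h
  refine ⟨by rw [hr c (by simp [h1]), h1], h2.mono hr, h3.mono hF (.inr rfl), hF.apply_eq h4 ?_⟩
  have := h2.2
  simp; omega

theorem Blinded.mono (hF : Grows F l F') (hr : ∀ x, role x ≠ .unused → role' x = role x)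
    {p v c ch a i u : ℕ} (h : Blinded m role ls F p v c ch a i u) :
    Blinded m role' (ls ++ [l]) F' p v c ch a i u := by
  obtain ⟨h1, h2, h3, h4, h5⟩ := h
  exact ⟨h1.mono hF hr, by rw [hr a (by simp [h2]), h2], h3, h4.mono hF (.inl h1.2.1.2),
    hF.apply_eq h5 (by simp)⟩

theorem Started.mono (hF : Grows F l F') (hr : ∀ x, role x ≠ .unused → role' x = role x)
    {ch t i : ℕ} {M₁ : Term} (h : Started m role ls F ch t i M₁) :
    Started m role' (ls ++ [l]) F' ch t i M₁ := by
  obtain ⟨h1, h2, h3⟩ := h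
  exact ⟨h1.mono hr, by rw [hr t (by simp [h2]), h2], h3.mono hF (.inl h1.2)⟩

theorem Replied.mono (hF : Grows F l F') (hr : ∀ x, role x ≠ .unused → role' x = role x)
    {ch t i j u : ℕ} {M₁ : Term} (h : Replied m role ls F ch t i j u M₁) :
    Replied m role' (ls ++ [l]) F' ch t i j u M₁ := by
  obtain ⟨h1, h2, h3, h4⟩ := h
  exact ⟨h1.mono hF hr, h2, h3.mono hF (.inl h1.1.2), hF.apply_eq h4 (by simp)⟩

theorem freshInTerm_of_key {a c y s : Term} (h : l.FreshInTerm (.enc s (key m a c y))) :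
    l.FreshInTerm y := by
  cases l with
  | out M u =>
    unfold key at h
    split at h
    · exact h.2.2.2
    · exact h.2.2
  | _ => trivial

theorem Finished.mono (hF : Grows F l F') (hr : ∀ x, role x ≠ .unused → role' x = role x)
    {p v c ch a i j k u uk : ℕ} {M y : Term}
    (h : Finished m role ls F p v c ch a M y i j k u uk) :
    Finished m role' (ls ++ [l]) F' p v c ch a M y i j k u uk := by
  obtain ⟨h1, h2, h3, h4, h5, h6, h7⟩ := h
  refine ⟨hF.subst_eq ?_ h1, h2.mono hF hr, h3, h4.mono hF (.inl h2.1.2.1.2), h5,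
    h6.mono hF (.inl h2.1.2.1.2), hF.apply_eq h7 (by simp)⟩
  -- The value `y` occurs in the ciphertext, and hence in the frame.
  exact freshInTerm_of_key (h7 ▸ hF.freshInTerm (by simp [h7]))

theorem Agrees.mono (hF : Grows F l F') (hr : ∀ x, role x ≠ .unused → role' x = role x)
    {L L' : Multiset Session}
    (hL : ∀ p v c ch a M y k uk, Session.cardDone p v c ch a M y k uk ∈ L →
      Session.cardDone p v c ch a M y k uk ∈ L')
    {ch t pos p : ℕ} (h : Agrees m role ls F L ch t pos p) :
    Agrees m role' (ls ++ [l]) F' L' ch t pos p := by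
  obtain ⟨v, c, ch', a, M, y, i', j', k', u', uk, h1, h2, hf, i, j, u, k, M₁, M₂, h3, h4, h5, h6,
    h7, h8, h9⟩ := h
  exact ⟨v, c, ch', a, M, y, i', j', k', u', uk, hL _ _ _ _ _ _ _ _ _ h1, h2, hf.mono hF hr,
    i, j, u, k, M₁, M₂, h3.mono hF hr, h4, h5.mono hF (.inl h3.1.1.2), h6, hF.eqE h7, hF.eqE h8,
    hF.eqE h9⟩

theorem freshInTerm_of_verify {s t z₁ z₂ : Term} {P : Proc}
    (h : l.FreshIn (verify m s t z₁ z₂ P)) :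
    l.FreshInTerm z₁ ∧ l.FreshInTerm z₂ := by
  cases l with
  | out M u =>
    unfold verify at h
    split at h
    · exact ⟨h.1.1.2, h.1.2⟩
    · exact ⟨h.1.1.2, h.1.2⟩
  | _ => exact ⟨trivial, trivial⟩

theorem freshInTerm_of_terminalAfterSend {s ch t z₁ : Term}
    (h : l.FreshIn (terminalAfterSend m s ch t z₁)) : l.FreshInTerm z₁ := by
  cases l with
  | out M u =>
    have h : (verify m s.up t.up z₁.up (.var 0) (.send ch.up .auth .nil)).Fresh (2 * u + 1) := h.2
    unfold verify at h
    split at h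
    · exact Term.fresh_up.1 h.1.1.2
    · exact Term.fresh_up.1 h.1.1.2
  | _ => trivial

/-- The past of a session stays valid. The values that it still uses do not contain the new
variable, as this is fresh for the rest of the session. -/
theorem Session.Ok.mono (hF : Grows F l F') (hr : ∀ x, role x ≠ .unused → role' x = role x)
    {s : Session} (hs : l.FreshIn (s.proc m)) (h : s.Ok m role ls F) :
    s.Ok m role' (ls ++ [l]) F' := by
  cases s with
  | cards => trivial
  | cardSessions c => exact (hr c (by simp [show role c = .card from h])).trans h
  | card => exact Announced.mono hF hr h
  | cardAfterSend =>
    obtain ⟨i, u, h⟩ := h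
    exact ⟨i, u, h.mono hF hr⟩
  | cardAfterRecv p v c ch a M y =>
    obtain ⟨h1, i, j, u, h2, h3, h4⟩ := h
    refine ⟨hF.subst_eq ?_ h1, i, j, u, h2.mono hF hr, h3, h4.mono hF (.inl h2.1.2.1.2)⟩
    refine freshInTerm_of_key (m := m) (a := .var a) (c := .var c)
      (s := plain m (.var 1) (.var c) (.var a)) ?_
    cases l with
    | out M u => exact hs.2.1
    | _ => trivial
  | cardDone =>
    obtain ⟨i, j, u, h⟩ := h
    exact ⟨i, j, u, h.mono hF hr⟩
  | issuer => trivial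
  | terminals => trivial
  | terminal => exact IsChannel.mono hr h
  | terminalAfterRecv =>
    obtain ⟨h1, i, h2⟩ := h
    refine ⟨hF.subst_eq ?_ h1, i, h2.mono hF hr⟩
    cases l with
    | out M u => exact freshInTerm_of_terminalAfterSend (l := .out M u) hs.2.2
    | _ => trivial
  | terminalAfterSend =>
    obtain ⟨h1, i, j, u, h2⟩ := h
    exact ⟨hF.subst_eq (freshInTerm_of_terminalAfterSend hs) h1, i, j, u, h2.mono hF hr⟩
  | verify =>
    obtain ⟨h1, h2, i, j, u, k, h3, h4, h5⟩ := h
    exact ⟨hF.subst_eq (freshInTerm_of_verify hs).1 h1,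
      hF.subst_eq (freshInTerm_of_verify hs).2 h2, i, j, u, k, h3.mono hF hr, h4,
      h5.mono hF (.inl h3.1.1.2)⟩
  | terminalDone =>
    obtain ⟨h1, h2, u, h3⟩ := h
    exact ⟨h1.mono hr, by rw [hr _ (by simp [h2]), h2], u, h3.mono hF (.inl h1.2)⟩

end Mono

/-! ### The invariant -/

/-- Some card has sent the encryption of the plaintext with the normal form `M`, with a key whose
normal form is `K`. -/
def Honest (m : Mode) (L : Multiset Session) (M K : Term) : Prop :=
  ∃ p v c ch a N y k uk, .cardDone p v c ch a N y k uk ∈ L ∧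
    M = nf m (plain m (.var 1) (.var c) (.var a)) ∧ K = nf m (key m (.var a) (.var c) y)

/-- The invariant of the reachable states. The actions so far are `ls`, the frame is `F`, and `n`
private names have been generated, whose use is given by `role`. The parallel components of the
process `P`, with their past, are `L`. -/
structure Inv (m : Mode) (ls : List Label) (F : Subst) (n : ℕ) (P : Proc) (role : ℕ → Role)
    (L : Multiset Session) : Prop where
  parts_eq : parts P = L.map (Session.proc m)
  pos : 0 < n
  role_one : role 1 = .signing
  role_even : ∀ x, role (2 * x) = .pub
  role_unused : ∀ k, n ≤ k → role (2 * k + 1) = .unused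
  cards_mem : .cards ∈ L
  ok : ∀ s ∈ L, s.Ok m role ls F
  nodup_card : (L.filterMap Session.cardId).Nodup
  nodup_terminal : (L.filterMap Session.terminalId).Nodup
  known : ∀ x, Known m role (Honest m L) (nf m (F x))
  cardName_eq : F cardName = .var (2 * cardName)
  /-- Only finished terminals have sent `auth`. -/
  auth : ∀ a M w, ls[a]? = some (.out M w) → F w ≠ .var (2 * w) ∧
    (nf m (F w) = .auth → ∃ ch t, .terminalDone ch t a ∈ L)
  agrees : ∀ ch t a, .terminalDone ch t a ∈ L → ∃ p, Agrees m role ls F L ch t a p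

/-- Announcements lie in the past, so that the position of a new one is a new identifier. -/
theorem Session.Ok.cardId_lt {m : Mode} {role : ℕ → Role} {ls : List Label} {F : Subst}
    {s : Session} (h : s.Ok m role ls F) {p : ℕ} (hp : s.cardId = some p) : p < ls.length := by
  have key : ∀ {p v c ch}, Announced m role ls F p v c ch → p < ls.length := by
    rintro p v c ch ⟨-, -, ⟨M, h, -⟩, -⟩
    exact (List.getElem?_eq_some_iff.1 h).1
  cases s <;> simp only [cardId, Option.some.injEq, reduceCtorEq] at hp <;> subst hp
  · exact key h
  · obtain ⟨_, _, h⟩ := h; exact key h.1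
  · obtain ⟨_, _, _, _, h, _⟩ := h; exact key h.1
  · obtain ⟨_, _, _, _, h, _⟩ := h; exact key h.1

theorem Session.Ok.role_terminalId {m : Mode} {role : ℕ → Role} {ls : List Label} {F : Subst}
    {s : Session} (h : s.Ok m role ls F) {t : ℕ} (ht : s.terminalId = some t) :
    role t = .terminal := by
  cases s <;> simp only [terminalId, Option.some.injEq, reduceCtorEq] at ht <;> subst ht
  · obtain ⟨_, _, h⟩ := h; exact h.2.1
  · obtain ⟨_, _, _, _, h⟩ := h; exact h.1.2.1
  · obtain ⟨_, _, _, _, _, _, h, _⟩ := h; exact h.1.2.1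
  · exact h.2.1

/-- A session that is finished. -/
def Session.IsDone : Session → Prop
  | cardDone .. => True
  | terminalDone .. => True
  | _ => False

/-- The message sent by a transition, if any, is not the variable that holds it, and has the
property `p`. -/
def Label.OutSat (F' : Subst) (p : Term → Prop) : Label → Prop
  | out _ u => F' u ≠ .var (2 * u) ∧ p (F' u)
  | _ => True

/-- The invariant is preserved by a transition that replaces the session `s` by the sessions `S`. -/
theorem Inv.step {m : Mode} {ls : List Label} {F F' : Subst} {n n' : ℕ} {P P' : Proc}
    {role role' : ℕ → Role} {s : Session} {R S : Multiset Session} {l : Label}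
    (h : Inv m ls F n P role (s ::ₘ R)) (hs : ¬ s.IsDone)
    (hR : ∀ r ∈ R, l.FreshIn (r.proc m)) (hF : Grows F l F')
    (hr : ∀ x, role x ≠ .unused → role' x = role x) (hn : n ≤ n')
    (hr' : ∀ k, n' ≤ k → role' (2 * k + 1) = .unused)
    (hP : parts P' = S.map (Session.proc m) + R.map (Session.proc m))
    (hcards : s = .cards → .cards ∈ S)
    (hok : ∀ r ∈ S, r.Ok m role' (ls ++ [l]) F')
    (hcard : S.filterMap Session.cardId = ({s} : Multiset Session).filterMap Session.cardId ∨
      S.filterMap Session.cardId = {ls.length})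
    (hterm : S.filterMap Session.terminalId =
        ({s} : Multiset Session).filterMap Session.terminalId ∨
      ∃ t, role t = .unused ∧ S.filterMap Session.terminalId = {t})
    (hout : l.OutSat F' fun N => Known m role' (Honest m (S + R)) (nf m N) ∧
      (nf m N = .auth → ∃ ch t, .terminalDone ch t ls.length ∈ S))
    (hagrees : ∀ ch t a, .terminalDone ch t a ∈ S →
      ∃ p, Agrees m role' (ls ++ [l]) F' (S + R) ch t a p) :
    Inv m (ls ++ [l]) F' n' P' role' (S + R) := by
  have hcons : ∀ {α : Type} (f : Session → Option α), (s ::ₘ R).filterMap f =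
      ({s} : Multiset Session).filterMap f + R.filterMap f := fun f => by
    rw [← Multiset.filterMap_add, Multiset.singleton_add]
  have hdone : ∀ {r : Session}, r.IsDone → r ∈ s ::ₘ R → r ∈ S + R := fun hr hrm => by
    rcases Multiset.mem_cons.1 hrm with rfl | hrm
    · exact absurd hr hs
    · exact Multiset.mem_add.2 (.inr hrm)
  have hhon : ∀ M K, Honest m (s ::ₘ R) M K → Honest m (S + R) M K := by
    rintro M K ⟨p, v, c, ch, a, N, y, k, uk, h1, h2⟩
    exact ⟨p, v, c, ch, a, N, y, k, uk, hdone trivial h1, h2⟩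
  refine ⟨by rw [hP, Multiset.map_add], h.pos.trans_le hn,
    by rw [hr 1 (by simp [h.role_one]), h.role_one],
    fun x => by rw [hr _ (by simp [h.role_even]), h.role_even], hr', ?_, fun r hrm => ?_, ?_, ?_,
    fun x => ?_, hF.exists_subst.elim fun τ hτ => ?_, ?_, fun ch t a ha => ?_⟩
  · rcases Multiset.mem_cons.1 h.cards_mem with hc | hc
    · exact Multiset.mem_add.2 (.inl (hcards hc.symm))
    · exact Multiset.mem_add.2 (.inr hc)
  · rcases Multiset.mem_add.1 hrm with hrm | hrm
    · exact hok r hrm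
    · exact (h.ok r (Multiset.mem_cons_of_mem hrm)).mono hF hr (hR r hrm)
  · rw [Multiset.filterMap_add]
    have hnd := h.nodup_card
    rw [hcons] at hnd
    rcases hcard with hc | hc
    · rwa [hc]
    · rw [hc, Multiset.singleton_add, Multiset.nodup_cons]
      refine ⟨fun hm => ?_, (Multiset.nodup_add.1 hnd).2.1⟩
      obtain ⟨r, hrm, hp⟩ := (Multiset.mem_filterMap _ _).1 hm
      exact absurd ((h.ok r (Multiset.mem_cons_of_mem hrm)).cardId_lt hp) (lt_irrefl _)
  · rw [Multiset.filterMap_add]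
    have hnd := h.nodup_terminal
    rw [hcons] at hnd
    rcases hterm with hc | ⟨t, ht, hc⟩
    · rwa [hc]
    · rw [hc, Multiset.singleton_add, Multiset.nodup_cons]
      refine ⟨fun hm => ?_, (Multiset.nodup_add.1 hnd).2.1⟩
      obtain ⟨r, hrm, hp⟩ := (Multiset.mem_filterMap _ _).1 hm
      simp [(h.ok r (Multiset.mem_cons_of_mem hrm)).role_terminalId hp] at ht
  · have hx := (h.known x).mono hr hhon
    cases l with
    | out M u =>
      obtain ⟨-, -, N, rfl⟩ := hF
      by_cases hxu : x = u
      · subst hxu; exact hout.2.1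
      · rwa [Function.update_of_ne hxu]
    | _ => cases hF; exact hx
  · have := hτ.1 (.var cardName)
    simp only [Term.subst, h.cardName_eq] at this
    rw [this, hτ.2.2 _ (.inr rfl)]
  · intro a M w ha
    by_cases hal : a < ls.length
    · rw [List.getElem?_append_left hal] at ha
      obtain ⟨h1, h2⟩ := h.auth a M w ha
      rw [hF.apply_eq rfl h1]
      refine ⟨h1, fun hw => ?_⟩
      obtain ⟨ch, t, h3⟩ := h2 hw
      exact ⟨ch, t, hdone trivial h3⟩
    · have hal' : a = ls.length := by
        have := (List.getElem?_eq_some_iff.1 ha).1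
        simp at this; omega
      subst hal'
      simp only [List.getElem?_concat_length, Option.some.injEq] at ha
      subst ha
      obtain ⟨h1, h2, h3⟩ := hout
      refine ⟨h1, fun hw => ?_⟩
      obtain ⟨ch, t, h4⟩ := h3 hw
      exact ⟨ch, t, Multiset.mem_add.2 (.inl h4)⟩
  · rcases Multiset.mem_add.1 ha with ha | ha
    · exact hagrees ch t a ha
    · obtain ⟨p, hp⟩ := h.agrees ch t a (Multiset.mem_cons_of_mem ha)
      exact ⟨p, hp.mono hF hr fun _ _ _ _ _ _ _ _ _ h => hdone trivial h⟩

/-! ### The transitions of the sessions -/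

section Transitions

variable {m : Mode} {F F' : Subst} {n n' : ℕ} {P' : Proc} {l : Label} {s c ch t a : Term}

theorem send_step {Ax : Axioms} {N : Term} {P : Proc}
    (h : FlatStep Ax F n (.send ch N P) l F' n' P') :
    ∃ M u, l = .out M u ∧ EqE Ax (M.subst F) ch ∧ New F u ∧ F' = Function.update F u N ∧
      n' = n ∧ P' = P := by
  cases h with
  | out h1 _ _ h4 h5 => exact ⟨_, _, rfl, h1, ⟨h4, h5⟩, rfl, rfl, rfl⟩

theorem recv_step {Ax : Axioms} {P : Proc} (h : FlatStep Ax F n (.recv ch P) l F' n' P') :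
    ∃ M N, l = .inp M N ∧ EqE Ax (M.subst F) ch ∧ F' = F ∧ n' = n ∧
      P' = P.subst (.inst (N.subst F)) := by
  cases h with
  | inp h => exact ⟨_, _, rfl, h, rfl, rfl, rfl⟩

theorem cardSessions_step (h : FlatStep m.ax F n (cardSessions m s c) l F' n' P') :
    ∃ M u, l = .out M u ∧ EqE m.ax (M.subst F) (.var (2 * cardName)) ∧ New F u ∧
      F' = Function.update F u (.var (2 * n + 1)) ∧ n' = n + 1 ∧
      P' = .par (card m s c (.var (2 * n + 1))) (cardSessions m s c) := by
  cases h with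
  | rep h _ =>
    cases h with
    | nu h =>
      simp only [Proc.subst, card_subst, Term.up_subst_inst] at h
      obtain ⟨M, u, rfl, h1, h2, h3, h4, rfl⟩ := send_step h
      exact ⟨M, u, rfl, h1, h2, h3, h4, rfl⟩

theorem cards_step (h : FlatStep m.ax F n (cards m s) l F' n' P') :
    ∃ M u, l = .out M u ∧ EqE m.ax (M.subst F) (.var (2 * cardName)) ∧ New F u ∧
      F' = Function.update F u (.var (2 * (n + 1) + 1)) ∧ n' = n + 2 ∧
      P' = .par (.par (card m s (.var (2 * n + 1)) (.var (2 * (n + 1) + 1)))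
        (cardSessions m s (.var (2 * n + 1)))) (cards m s) ∧ l.FreshIn (cards m s) := by
  cases h with
  | rep h hf =>
    cases h with
    | nu h =>
      have : (Proc.rep <| .nu <| .send (.var 4) (.var 0) <|
          card m s.up.up (.var 1) (.var 0)).subst (.inst (.var (2 * n + 1))) =
          cardSessions m s (.var (2 * n + 1)) := by
        simp only [Proc.subst, card_subst, Term.up_subst_inst, Term.up_subst_lift]
        rfl
      rw [this] at h
      obtain ⟨M, u, rfl, h1, h2, h3, h4, rfl⟩ := cardSessions_step h
      exact ⟨M, u, rfl, h1, h2, h3, h4, rfl, hf⟩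

theorem terminals_step (h : FlatStep m.ax F n (terminals m s) l F' n' P') :
    ∃ M u, l = .out M u ∧ New F u ∧ F' = Function.update F u (.var (2 * n + 1)) ∧ n' = n + 1 ∧
      P' = .par (terminal m s (.var (2 * n + 1))) (terminals m s) := by
  cases h with
  | rep h _ =>
    cases h with
    | nu h =>
      simp only [Proc.subst, terminal_subst, Term.up_subst_inst] at h
      obtain ⟨M, u, rfl, -, h2, h3, h4, rfl⟩ := send_step h
      exact ⟨M, u, rfl, h2, h3, h4, rfl⟩

theorem card_step (h : FlatStep m.ax F n (card m s c ch) l F' n' P') :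
    ∃ M u, l = .out M u ∧ EqE m.ax (M.subst F) ch ∧ New F u ∧
      F' = Function.update F u (.smult (.var (2 * n + 1)) (.smult c .g)) ∧ n' = n + 1 ∧
      P' = cardAfterSend m s c ch (.var (2 * n + 1)) := by
  cases h with
  | nu h =>
    simp only [Proc.subst, Term.subst, Term.up_subst_inst] at h
    obtain ⟨M, u, rfl, h1, h2, h3, h4, rfl⟩ := send_step h
    refine ⟨M, u, rfl, h1, h2, h3, h4, ?_⟩
    simp only [cardAfterSend, Term.subst, plain_subst, key_subst, Term.up_subst_lift,
      Term.up_subst_inst]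
    rfl

theorem cardAfterSend_step (h : FlatStep m.ax F n (cardAfterSend m s c ch a) l F' n' P') :
    ∃ M N, l = .inp M N ∧ EqE m.ax (M.subst F) ch ∧ F' = F ∧ n' = n ∧
      P' = cardAfterRecv m s c ch a (N.subst F) := by
  obtain ⟨M, N, h1, h2, h3, h4, rfl⟩ := recv_step h
  refine ⟨M, N, h1, h2, h3, h4, ?_⟩
  simp only [cardAfterRecv, Proc.subst, Term.subst, plain_subst, key_subst, Term.up_subst_inst]
  rfl

theorem terminal_step (h : FlatStep m.ax F n (terminal m s ch) l F' n' P') :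
    ∃ M N, l = .inp M N ∧ EqE m.ax (M.subst F) ch ∧ F' = F ∧ n' = n + 1 ∧
      P' = terminalAfterRecv m s ch (.var (2 * n + 1)) (N.subst F) := by
  cases h with
  | nu h =>
    simp only [Proc.subst, Term.up_subst_inst] at h
    obtain ⟨M, N, h1, h2, h3, h4, rfl⟩ := recv_step h
    refine ⟨M, N, h1, h2, h3, h4, ?_⟩
    simp only [terminalAfterRecv, terminalAfterSend, Proc.subst, Term.subst, verify_subst,
      Term.up_subst_lift, Term.up_subst_inst]
    rfl

theorem terminalAfterSend_step {z₁ : Term}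
    (h : FlatStep m.ax F n (terminalAfterSend m s ch t z₁) l F' n' P') :
    ∃ M N, l = .inp M N ∧ EqE m.ax (M.subst F) ch ∧ F' = F ∧ n' = n ∧
      P' = verify m s t z₁ (N.subst F) (.send ch .auth .nil) := by
  obtain ⟨M, N, h1, h2, h3, h4, rfl⟩ := recv_step h
  refine ⟨M, N, h1, h2, h3, h4, ?_⟩
  simp only [Proc.subst, Term.subst, verify_subst, Term.up_subst_inst]
  rfl

theorem verify_step {z₁ z₂ : Term} {P : Proc}
    (h : FlatStep m.ax F n (verify m (.var 1) t z₁ z₂ P) l F' n' P') :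
    Accepts m (nf m t) (nf m z₁) (nf m z₂) ∧ FlatStep m.ax F n P l F' n' P' := by
  unfold verify at h
  unfold Accepts
  split at h <;> cases h with
  | mat h h1 =>
    cases h with
    | mat h h2 =>
      rename_i hf
      simp only [hf, if_true]
      exact ⟨⟨eqE_iff_nf_eq.1 h1, eqE_iff_nf_eq.1 h2⟩, h⟩

end Transitions

/-- The new variable is not the name `card`, which occurs in the process of all cards. -/
theorem New.grows {m : Mode} {F : Subst} {u : ℕ} (h : New F u) {M : Term}
    (hc : (Label.out M u).FreshIn (cards m (.var 1))) (N : Term) :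
    Grows F (.out M u) (Function.update F u N) := by
  refine ⟨?_, h, N, rfl⟩
  rintro rfl
  exact hc.1 rfl

section Steps

variable {m : Mode} {ls : List Label} {F F' : Subst} {n n' : ℕ} {P P' p' : Proc}
  {role : ℕ → Role} {R : Multiset Session} {l : Label}

/-- A new private name may be given any use. -/
theorem update_role {role : ℕ → Role} {x : ℕ} (hx : role x = .unused) (r : Role) (y : ℕ)
    (hy : role y ≠ .unused) : Function.update role x r y = role y :=
  Function.update_of_ne (by rintro rfl; exact hy hx) _ _

theorem Inv.freshIn_cards {s : Session} (h : Inv m ls F n P role (s ::ₘ R)) (hs : s ≠ .cards)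
    (hR : ∀ r ∈ R, l.FreshIn (r.proc m)) : l.FreshIn (cards m (.var 1)) :=
  hR _ ((Multiset.mem_cons.1 h.cards_mem).resolve_left (Ne.symm hs))

theorem Grows.sent {M N : Term} {u x : ℕ} (hF : Grows F (.out M u) (Function.update F u N))
    (hx : x % 2 = 1 ∨ x = 2 * cardName) (h : EqE m.ax (M.subst F) (.var x)) :
    Sent m (ls ++ [.out M u]) (Function.update F u N) ls.length x u :=
  ⟨M, by simp, hF.eqE_var hx h⟩

theorem received_last {M N : Term} {x : ℕ} (h : EqE m.ax (M.subst F) (.var x)) :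
    Received m (ls ++ [.inp M N]) F ls.length x N :=
  ⟨M, by simp, h⟩

theorem Sent.lt {i x u : ℕ} (h : Sent m ls F i x u) : i < ls.length := by
  obtain ⟨M, h, -⟩ := h; exact (List.getElem?_eq_some_iff.1 h).1

theorem Received.lt {i x : ℕ} {N : Term} (h : Received m ls F i x N) : i < ls.length := by
  obtain ⟨M, h, -⟩ := h; exact (List.getElem?_eq_some_iff.1 h).1

theorem parts_verify (m : Mode) (s t z₁ z₂ : Term) (P : Proc) :
    parts (verify m s t z₁ z₂ P) = {verify m s t z₁ z₂ P} := by
  unfold verify; split <;> rfl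

theorem Inv.step_cards (h : Inv m ls F n P role (.cards ::ₘ R))
    (hst : FlatStep m.ax F n (Session.cards.proc m) l F' n' p')
    (hR : ∀ r ∈ R, l.FreshIn (r.proc m)) (hP : parts P' = parts p' + R.map (Session.proc m)) :
    ∃ role' S, Inv m (ls ++ [l]) F' n' P' role' (S + R) := by
  obtain ⟨M, u, rfl, hM, hu, rfl, rfl, rfl, hf⟩ := cards_step hst
  have hF := hu.grows hf (.var (2 * (n + 1) + 1))
  have h1 := h.role_unused n le_rfl
  have h2 := h.role_unused (n + 1) (by omega)
  have h3 : (Function.update role (2 * n + 1) .card) (2 * (n + 1) + 1) = .unused := by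
    rw [Function.update_of_ne (by omega), h2]
  have hc : IsChannel (Function.update (Function.update role (2 * n + 1) .card)
      (2 * (n + 1) + 1) .pub) (2 * (n + 1) + 1) := ⟨by simp, by omega⟩
  have hcard : Function.update (Function.update role (2 * n + 1) .card)
      (2 * (n + 1) + 1) .pub (2 * n + 1) = .card := by
    rw [Function.update_of_ne (by omega)]; simp
  refine ⟨Function.update (Function.update role (2 * n + 1) .card) (2 * (n + 1) + 1) .pub,
    {.card ls.length u (2 * n + 1) (2 * (n + 1) + 1), .cardSessions (2 * n + 1), .cards},
    h.step (by simp [Session.IsDone]) hR hF (fun x hx => ?_) (by omega) (fun k hk => ?_)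
      (by exact hP) (by simp) (fun r hr => ?_) (.inr rfl) (.inl rfl) ⟨?_, ?_, ?_⟩ (by simp)⟩
  · rw [update_role h3 _ _ (by rwa [update_role h1 _ _ hx]), update_role h1 _ _ hx]
  · rw [Function.update_of_ne (by omega), Function.update_of_ne (by omega),
      h.role_unused k (by omega)]
  · simp only [Multiset.insert_eq_cons, Multiset.mem_cons, Multiset.mem_singleton] at hr
    rcases hr with rfl | rfl | rfl
    · exact ⟨hcard, hc, hF.sent (.inr rfl) hM, by simp⟩
    · exact hcard
    · trivial
  · simp; omega
  · simp only [Function.update_self]; exact .var hc.1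
  · simp [nf]

theorem Inv.step_cardSessions {c : ℕ} (h : Inv m ls F n P role (.cardSessions c ::ₘ R))
    (hst : FlatStep m.ax F n ((Session.cardSessions c).proc m) l F' n' p')
    (hR : ∀ r ∈ R, l.FreshIn (r.proc m)) (hP : parts P' = parts p' + R.map (Session.proc m)) :
    ∃ role' S, Inv m (ls ++ [l]) F' n' P' role' (S + R) := by
  obtain ⟨M, u, rfl, hM, hu, rfl, rfl, rfl⟩ := cardSessions_step hst
  have hF := hu.grows (h.freshIn_cards (by simp) hR) (.var (2 * n + 1))
  have h1 := h.role_unused n le_rfl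
  have hc : IsChannel (Function.update role (2 * n + 1) .pub) (2 * n + 1) := ⟨by simp, by omega⟩
  have hcard : Function.update role (2 * n + 1) .pub c = .card := by
    have hc : role c = .card := h.ok (.cardSessions c) (by simp)
    rw [update_role h1 _ _ (by simp [hc]), hc]
  refine ⟨Function.update role (2 * n + 1) .pub,
    {.card ls.length u c (2 * n + 1), .cardSessions c},
    h.step (by simp [Session.IsDone]) hR hF (fun x hx => update_role h1 _ _ hx) (by omega)
      (fun k hk => ?_) (by exact hP) (by simp) (fun r hr => ?_) (.inr rfl) (.inl rfl)
      ⟨?_, ?_, ?_⟩ (by simp)⟩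
  · rw [Function.update_of_ne (by omega), h.role_unused k (by omega)]
  · simp only [Multiset.insert_eq_cons, Multiset.mem_cons, Multiset.mem_singleton] at hr
    rcases hr with rfl | rfl
    · exact ⟨hcard, hc, hF.sent (.inr rfl) hM, by simp⟩
    · exact hcard
  · simp; omega
  · simp only [Function.update_self]; exact .var hc.1
  · simp [nf]

/-- The blinded public key of a card is known. -/
theorem known_blinded {hon : Term → Term → Prop} {a c : ℕ} (ha : role a = .pub)
    (hc : (role c).Secret) : Known m role hon (nf m (.smult (.var a) (.smult (.var c) .g))) := by
  refine Known.mkSmult (.var ha) ?_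
  simp only [nf, mkSmult_g]
  exact .point (S := 0) hc rfl (by simp [scal, factors]) (by simp)

theorem Inv.step_card {p v c ch : ℕ} (h : Inv m ls F n P role (.card p v c ch ::ₘ R))
    (hst : FlatStep m.ax F n ((Session.card p v c ch).proc m) l F' n' p')
    (hR : ∀ r ∈ R, l.FreshIn (r.proc m)) (hP : parts P' = parts p' + R.map (Session.proc m)) :
    ∃ role' S, Inv m (ls ++ [l]) F' n' P' role' (S + R) := by
  obtain ⟨M, u, rfl, hM, hu, rfl, rfl, rfl⟩ := card_step hst
  have hF := hu.grows (h.freshIn_cards (by simp) hR)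
    (.smult (.var (2 * n + 1)) (.smult (.var c) .g))
  have h1 := h.role_unused n le_rfl
  have hr := update_role h1 .pub
  have ha : Function.update role (2 * n + 1) .pub (2 * n + 1) = .pub := by simp
  have h2 : Announced m role ls F p v c ch := h.ok _ (Multiset.mem_cons_self _ _)
  have h3 := h2.mono hF hr
  refine ⟨Function.update role (2 * n + 1) .pub, {.cardAfterSend p v c ch (2 * n + 1)},
    h.step (by simp [Session.IsDone]) hR hF hr (by omega)
      (fun k hk => ?_) (by exact hP) (by simp) (fun r hr => ?_) (.inl rfl) (.inl rfl)
      ⟨?_, ?_, ?_⟩ (by simp)⟩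
  · rw [Function.update_of_ne (by omega), h.role_unused k (by omega)]
  · rw [Multiset.mem_singleton] at hr
    subst hr
    exact ⟨ls.length, u, h3, ha, h2.2.2.1.lt, hF.sent (.inl h2.2.1.2) hM, by simp⟩
  · simp
  · simp only [Function.update_self]
    exact known_blinded ha (.inl h3.1)
  · intro h
    have := congrArg (scal m) h
    simp only [Function.update_self, nf, mkSmult_g] at this
    rw [scal_mkSmult_of_base _ rfl] at this
    simp [scal, factors] at this

theorem Inv.step_cardAfterSend {p v c ch a : ℕ}
    (h : Inv m ls F n P role (.cardAfterSend p v c ch a ::ₘ R))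
    (hst : FlatStep m.ax F n ((Session.cardAfterSend p v c ch a).proc m) l F' n' p')
    (hR : ∀ r ∈ R, l.FreshIn (r.proc m)) (hP : parts P' = parts p' + R.map (Session.proc m)) :
    ∃ role' S, Inv m (ls ++ [l]) F' n' P' role' (S + R) := by
  obtain ⟨M, N, rfl, hM, rfl, rfl, rfl⟩ := cardAfterSend_step hst
  have hF : Grows F' (.inp M N) F' := rfl
  obtain ⟨i, u, h2⟩ := h.ok _ (Multiset.mem_cons_self _ _)
  refine ⟨role, {.cardAfterRecv p v c ch a N (N.subst F')},
    h.step (by simp [Session.IsDone]) hR hF (fun _ _ => rfl) le_rfl h.role_unused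
      (by exact hP) (by simp) (fun r hr => ?_) (.inl rfl) (.inl rfl) trivial (by simp)⟩
  rw [Multiset.mem_singleton] at hr
  subst hr
  exact ⟨rfl, i, ls.length, u, h2.mono hF fun _ _ => rfl, h2.2.2.2.1.lt, received_last hM⟩

/-- The plaintext of the card's last message only consists of known messages. -/
theorem known_plain {hon : Term → Term → Prop} {a c : ℕ} (ha : role a = .pub)
    (hc : role c = .card) : Known m role hon (nf m (plain m (.var 1) (.var c) (.var a))) := by
  have h : CardPoint m role hon (.smult (.var c) .g) :=
    ⟨rfl, c, 0, hc, by simp [scal, factors], by simp⟩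
  have h' : Known m role hon (.sig (.var 1) (.smult (.var c) .g)) :=
    .cert hc rfl (S := 0) (by simp [scal, factors]) (by simp)
  unfold plain
  split
  · simp only [nf, mkSmult_g]
    exact .pair (.mkSmult (.var ha) h.known) (.mkSmult (.var ha) h')
  · simp only [nf, mkSmult_g]
    exact .pair (.pair (.var ha) h.known) (.pair h.known h')

theorem Inv.step_cardAfterRecv {p v c ch a : ℕ} {M y : Term}
    (h : Inv m ls F n P role (.cardAfterRecv p v c ch a M y ::ₘ R))
    (hst : FlatStep m.ax F n ((Session.cardAfterRecv p v c ch a M y).proc m) l F' n' p')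
    (hR : ∀ r ∈ R, l.FreshIn (r.proc m)) (hP : parts P' = parts p' + R.map (Session.proc m)) :
    ∃ role' S, Inv m (ls ++ [l]) F' n' P' role' (S + R) := by
  have hst' := hst
  obtain ⟨K, u, rfl, hM, hu, rfl, rfl, rfl⟩ := send_step hst
  have hF := hu.grows (h.freshIn_cards (by simp) hR)
    (.enc (plain m (.var 1) (.var c) (.var a)) (key m (.var a) (.var c) y))
  obtain ⟨h1, i, j, u', h2, h3, h4⟩ := h.ok _ (Multiset.mem_cons_self _ _)
  have hy : (Label.out K u).FreshInTerm y := by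
    cases hst' with
    | out _ h => exact freshInTerm_of_key (m := m) (l := .out K u) h
  have h5 := h2.mono hF fun _ _ => rfl
  refine ⟨role, {.cardDone p v c ch a M y ls.length u},
    h.step (by simp [Session.IsDone]) hR hF (fun _ _ => rfl) le_rfl h.role_unused
      (by exact hP) (by simp) (fun r hr => ?_) (.inl rfl) (.inl rfl) ⟨?_, ?_, ?_⟩ (by simp)⟩
  · rw [Multiset.mem_singleton] at hr
    subst hr
    exact ⟨i, j, u', hF.subst_eq hy h1, h5, h3, h4.mono hF (.inl h2.1.2.1.2), h4.lt,
      hF.sent (.inl h2.1.2.1.2) hM, by simp⟩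
  · simp
  · simp only [Function.update_self, nf]
    exact .honest (known_plain h2.2.1 h2.1.1)
      ⟨p, v, c, ch, a, M, y, ls.length, u, by simp, rfl, rfl⟩
  · simp [nf]

theorem Inv.step_issuer (h : Inv m ls F n P role (.issuer ::ₘ R))
    (hst : FlatStep m.ax F n (Session.issuer.proc m) l F' n' p')
    (hR : ∀ r ∈ R, l.FreshIn (r.proc m)) (hP : parts P' = parts p' + R.map (Session.proc m)) :
    ∃ role' S, Inv m (ls ++ [l]) F' n' P' role' (S + R) := by
  obtain ⟨M, u, rfl, hM, hu, rfl, rfl, rfl⟩ := send_step hst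
  have hF := hu.grows (h.freshIn_cards (by simp) hR) (.pks (.var 1))
  refine ⟨role, {.terminals},
    h.step (by simp [Session.IsDone]) hR hF (fun _ _ => rfl) le_rfl h.role_unused
      (by exact hP) (by simp) (fun r hr => ?_) (.inl rfl) (.inl rfl) ⟨?_, ?_, ?_⟩ (by simp)⟩
  · rw [Multiset.mem_singleton] at hr
    subst hr
    trivial
  · simp
  · simp only [Function.update_self]; exact .pksSigning
  · simp [nf]

theorem Inv.step_terminals (h : Inv m ls F n P role (.terminals ::ₘ R))
    (hst : FlatStep m.ax F n (Session.terminals.proc m) l F' n' p')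
    (hR : ∀ r ∈ R, l.FreshIn (r.proc m)) (hP : parts P' = parts p' + R.map (Session.proc m)) :
    ∃ role' S, Inv m (ls ++ [l]) F' n' P' role' (S + R) := by
  obtain ⟨M, u, rfl, hu, rfl, rfl, rfl⟩ := terminals_step hst
  have hF := hu.grows (h.freshIn_cards (by simp) hR) (.var (2 * n + 1))
  have h1 := h.role_unused n le_rfl
  have hc : IsChannel (Function.update role (2 * n + 1) .pub) (2 * n + 1) := ⟨by simp, by omega⟩
  refine ⟨Function.update role (2 * n + 1) .pub, {.terminal (2 * n + 1), .terminals},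
    h.step (by simp [Session.IsDone]) hR hF (fun x hx => update_role h1 _ _ hx) (by omega)
      (fun k hk => ?_) (by exact hP) (by simp) (fun r hr => ?_) (.inl rfl) (.inl rfl)
      ⟨?_, ?_, ?_⟩ (by simp)⟩
  · rw [Function.update_of_ne (by omega), h.role_unused k (by omega)]
  · simp only [Multiset.insert_eq_cons, Multiset.mem_cons, Multiset.mem_singleton] at hr
    rcases hr with rfl | rfl
    · exact hc
    · trivial
  · simp; omega
  · simp only [Function.update_self]; exact .var hc.1
  · simp [nf]

theorem Inv.step_terminal {ch : ℕ} (h : Inv m ls F n P role (.terminal ch ::ₘ R))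
    (hst : FlatStep m.ax F n ((Session.terminal ch).proc m) l F' n' p')
    (hR : ∀ r ∈ R, l.FreshIn (r.proc m)) (hP : parts P' = parts p' + R.map (Session.proc m)) :
    ∃ role' S, Inv m (ls ++ [l]) F' n' P' role' (S + R) := by
  obtain ⟨M, N, rfl, hM, rfl, rfl, rfl⟩ := terminal_step hst
  have hF : Grows F' (.inp M N) F' := rfl
  have h1 := h.role_unused n le_rfl
  have hr := update_role h1 .terminal
  have h2 : IsChannel role ch := h.ok _ (Multiset.mem_cons_self _ _)
  refine ⟨Function.update role (2 * n + 1) .terminal,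
    {.terminalAfterRecv ch (2 * n + 1) N (N.subst F')},
    h.step (by simp [Session.IsDone]) hR hF hr (by omega) (fun k hk => ?_) (by exact hP) (by simp)
      (fun r hr => ?_) (.inl rfl) (.inr ⟨_, h1, rfl⟩) trivial (by simp)⟩
  · rw [Function.update_of_ne (by omega), h.role_unused k (by omega)]
  · rw [Multiset.mem_singleton] at hr
    subst hr
    exact ⟨rfl, ls.length, h2.mono (update_role h1 .terminal), by simp, received_last hM⟩

theorem Inv.step_terminalAfterRecv {ch t : ℕ} {M₁ z₁ : Term}
    (h : Inv m ls F n P role (.terminalAfterRecv ch t M₁ z₁ ::ₘ R))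
    (hst : FlatStep m.ax F n ((Session.terminalAfterRecv ch t M₁ z₁).proc m) l F' n' p')
    (hR : ∀ r ∈ R, l.FreshIn (r.proc m)) (hP : parts P' = parts p' + R.map (Session.proc m)) :
    ∃ role' S, Inv m (ls ++ [l]) F' n' P' role' (S + R) := by
  have hst' := hst
  obtain ⟨M, u, rfl, hM, hu, rfl, rfl, rfl⟩ := send_step hst
  have hF := hu.grows (h.freshIn_cards (by simp) hR) (.smult (.var t) .g)
  obtain ⟨h1, i, h2⟩ := h.ok _ (Multiset.mem_cons_self _ _)
  have hz : (Label.out M u).FreshInTerm z₁ := by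
    cases hst' with
    | out _ _ h => exact freshInTerm_of_terminalAfterSend (m := m) (l := .out M u) h
  refine ⟨role, {.terminalAfterSend ch t M₁ z₁},
    h.step (by simp [Session.IsDone]) hR hF (fun _ _ => rfl) le_rfl h.role_unused
      (by exact hP) (by simp) (fun r hr => ?_) (.inl rfl) (.inl rfl) ⟨?_, ?_, ?_⟩ (by simp)⟩
  · rw [Multiset.mem_singleton] at hr
    subst hr
    exact ⟨hF.subst_eq hz h1, i, ls.length, u, h2.mono hF fun _ _ => rfl, h2.2.2.lt,
      hF.sent (.inl h2.1.2) hM, by simp⟩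
  · simp
  · simp only [Function.update_self, nf, mkSmult_g]
    exact .point (S := 0) (.inr h2.2.1) rfl (by simp [scal, factors]) (by simp)
  · simp [nf, mkSmult_g]

theorem Inv.step_terminalAfterSend {ch t : ℕ} {M₁ z₁ : Term}
    (h : Inv m ls F n P role (.terminalAfterSend ch t M₁ z₁ ::ₘ R))
    (hst : FlatStep m.ax F n ((Session.terminalAfterSend ch t M₁ z₁).proc m) l F' n' p')
    (hR : ∀ r ∈ R, l.FreshIn (r.proc m)) (hP : parts P' = parts p' + R.map (Session.proc m)) :
    ∃ role' S, Inv m (ls ++ [l]) F' n' P' role' (S + R) := by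
  obtain ⟨M, N, rfl, hM, rfl, rfl, rfl⟩ := terminalAfterSend_step hst
  have hF : Grows F' (.inp M N) F' := rfl
  obtain ⟨h1, i, j, u, h2⟩ := h.ok _ (Multiset.mem_cons_self _ _)
  rw [parts_verify] at hP
  refine ⟨role, {.verify ch t M₁ z₁ N (N.subst F')},
    h.step (by simp [Session.IsDone]) hR hF (fun _ _ => rfl) le_rfl h.role_unused
      (by exact hP) (by simp) (fun r hr => ?_) (.inl rfl) (.inl rfl) trivial (by simp)⟩
  rw [Multiset.mem_singleton] at hr
  subst hr
  exact ⟨h1, rfl, i, j, u, ls.length, h2.mono hF fun _ _ => rfl, h2.2.2.1.lt, received_last hM⟩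

/-- When a terminal signals success, the ciphertext that it accepted is the one of a finished card
session, and the two sessions agree. -/
theorem Inv.step_verify {ch t : ℕ} {M₁ z₁ M₂ z₂ : Term}
    (h : Inv m ls F n P role (.verify ch t M₁ z₁ M₂ z₂ ::ₘ R))
    (hst : FlatStep m.ax F n ((Session.verify ch t M₁ z₁ M₂ z₂).proc m) l F' n' p')
    (hR : ∀ r ∈ R, l.FreshIn (r.proc m)) (hP : parts P' = parts p' + R.map (Session.proc m)) :
    ∃ role' S, Inv m (ls ++ [l]) F' n' P' role' (S + R) := by
  obtain ⟨hacc, hst⟩ := verify_step hst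
  obtain ⟨M, u, rfl, hM, hu, rfl, rfl, rfl⟩ := send_step hst
  have hF := hu.grows (h.freshIn_cards (by simp) hR) .auth
  obtain ⟨rfl, rfl, i, j, v, k, h3, h4, h5⟩ := h.ok _ (Multiset.mem_cons_self _ _)
  have h3' := h3.mono hF fun _ _ => rfl
  refine ⟨role, {.terminalDone ch t ls.length},
    h.step (by simp [Session.IsDone]) hR hF (fun _ _ => rfl) le_rfl h.role_unused
      (by exact hP) (by simp) (fun r hr => ?_) (.inl rfl) (.inl rfl) ⟨?_, ?_, fun _ => ?_⟩
      fun ch' t' pos' hm => ?_⟩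
  · rw [Multiset.mem_singleton] at hr
    subst hr
    exact ⟨h3.1.1, h3.1.2.1, u, hF.sent (.inl h3.1.1.2) hM⟩
  · simp
  · simp only [Function.update_self]; exact .auth
  · exact ⟨ch, t, by simp⟩
  · obtain ⟨rfl, rfl, rfl⟩ : ch' = ch ∧ t' = t ∧ pos' = ls.length := by simpa using hm
    obtain ⟨N, hz₂, p, x, c, cch, a, K, y, k', uk, hmem, hN, hk⟩ :=
      hacc.exists_honest h.role_one h3.1.2.1 (Known.nf_subst h.known M₂)
    have hmem' := (Multiset.mem_cons.1 hmem).resolve_left (by simp)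
    obtain ⟨i', j', u', hf⟩ := h.ok _ hmem
    obtain ⟨hz₁, hy⟩ := Accepts.agree (hN ▸ hz₂) hk hacc
    refine ⟨p, x, c, cch, a, K, y, i', j', k', u', uk, Multiset.mem_add.2 (.inr hmem'),
      hf.2.2.2.2.2.1.lt, hf.mono hF fun _ _ => rfl, i, j, v, k, M₁, M₂, h3', h4,
      h5.mono hF (.inl h3.1.1.2), h5.lt, hF.eqE ?_, hF.eqE ?_, hF.eqE ?_⟩
    · rw [eqE_iff_nf_eq, hz₁, Term.subst, hf.2.1.2.2.2.2]
    · rw [eqE_iff_nf_eq, hf.1, hy, Term.subst, h3.2.2.2]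
    · rw [eqE_iff_nf_eq, hz₂, Term.subst, hf.2.2.2.2.2.2, nf, hN, hk]

/-- The invariant is preserved by all transitions. -/
theorem Inv.exists_inv {L : Multiset Session} (h : Inv m ls F n P role L)
    (hst : FlatStep m.ax F n P l F' n' P') :
    ∃ role' L', Inv m (ls ++ [l]) F' n' P' role' L' := by
  obtain ⟨p, R, p', h1, h2, h3, h4⟩ := hst.exists_part
  rw [h.parts_eq] at h1
  obtain ⟨s, hs, rfl⟩ := Multiset.mem_map.1 (h1 ▸ Multiset.mem_cons_self p R)
  obtain ⟨L, rfl⟩ := Multiset.exists_cons_of_mem hs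
  rw [Multiset.map_cons, Multiset.cons_inj_right] at h1
  subst h1
  replace h4 : ∀ r ∈ L, l.FreshIn (r.proc m) := fun r hr => h4 _ (Multiset.mem_map_of_mem _ hr)
  suffices ∃ role' S, Inv m (ls ++ [l]) F' n' P' role' (S + L) by
    obtain ⟨role', S, h⟩ := this; exact ⟨role', S + L, h⟩
  cases s with
  | cards => exact h.step_cards h2 h4 h3
  | cardSessions => exact h.step_cardSessions h2 h4 h3
  | card => exact h.step_card h2 h4 h3
  | cardAfterSend => exact h.step_cardAfterSend h2 h4 h3
  | cardAfterRecv => exact h.step_cardAfterRecv h2 h4 h3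
  | cardDone => cases h2
  | issuer => exact h.step_issuer h2 h4 h3
  | terminals => exact h.step_terminals h2 h4 h3
  | terminal => exact h.step_terminal h2 h4 h3
  | terminalAfterRecv => exact h.step_terminalAfterRecv h2 h4 h3
  | terminalAfterSend => exact h.step_terminalAfterSend h2 h4 h3
  | verify => exact h.step_verify h2 h4 h3
  | terminalDone => cases h2

end Steps

/-! ### Injective agreement -/

theorem Run.exists_inv {m : Mode} {A B : Ext} {ls' : List Label} (h : Run m.ax A ls' B)
    {ls : List Label} {F : Subst} {n : ℕ} {P : Proc} {role : ℕ → Role} {L : Multiset Session}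
    (hA : Flat 0 A F n P) (hI : Inv m ls F n P role L) :
    ∃ F n P role L, Flat 0 B F n P ∧ Inv m (ls ++ ls') F n P role L := by
  induction h generalizing ls F n P role L with
  | nil A => exact ⟨F, n, P, role, L, hA, by rwa [List.append_nil]⟩
  | @cons A l A' ls' B h1 _ ih =>
    obtain ⟨F', n', P', h2, h3⟩ := h1.flat l.shift_zero.symm hA
    obtain ⟨role', L', h4⟩ := hI.exists_inv h2
    obtain ⟨F, n, P, role, L, h5, h6⟩ := ih h3 h4
    exact ⟨F, n, P, role, L, h5, by simpa using h6⟩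

/-- The invariant holds once the signing key has been generated. -/
theorem Inv.init (m : Mode) : Inv m [] (fun x => .var (2 * x)) 1
    (.par (Session.cards.proc m) (Session.issuer.proc m))
    (fun x => if x % 2 = 0 then .pub else if x = 1 then .signing else .unused)
    {.cards, .issuer} where
  parts_eq := rfl
  pos := one_pos
  role_one := by simp
  role_even x := by simp
  role_unused k hk := by
    rw [if_neg (by omega), if_neg (by omega)]
  cards_mem := by simp
  ok r hr := by
    simp only [Multiset.insert_eq_cons, Multiset.mem_cons, Multiset.mem_singleton] at hr
    rcases hr with rfl | rfl <;> trivial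
  nodup_card := Multiset.nodup_zero
  nodup_terminal := Multiset.nodup_zero
  known x := .var (by simp)
  cardName_eq := rfl
  auth a M w h := by simp at h
  agrees ch t a h := by simp at h

theorem exists_inv_of_run {m : Mode} {B : Ext} {ls : List Label} (hls : ls ≠ [])
    (h : Run m.ax (.base .id (system (card m) (terminal m))) ls B) :
    ∃ F n P role L, Flat 0 B F n P ∧ Inv m ls F n P role L := by
  cases h with
  | nil => exact absurd rfl hls
  | @cons _ l A' ls _ h1 h2 =>
    have h3 : Flat 0 (.base .id (system (card m) (terminal m))) (fun x => .var (2 * x)) 0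
        ((system (card m) (terminal m)).subst (global 0)) :=
      ⟨rfl, by simp, fun _ => rfl, rfl⟩
    obtain ⟨F', n', P', h4, h5⟩ := h1.flat l.shift_zero.symm h3
    have h6 : FlatStep m.ax (fun x => .var (2 * x)) 1
        (.par (Session.cards.proc m) (Session.issuer.proc m)) l F' n' P' := by
      cases h4 with
      | nu h4 =>
        simp only [Proc.subst, card_subst, terminal_subst] at h4
        exact h4
    obtain ⟨role, L, h7⟩ := (Inv.init m).exists_inv h6
    exact h2.exists_inv h5 h7

theorem eq_of_nodup_filterMap {α β : Type*} {f : α → Option β} {s : Multiset α}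
    (h : (s.filterMap f).Nodup) {x y : α} (hx : x ∈ s) (hy : y ∈ s) {b : β} (hxb : f x = some b)
    (hyb : f y = some b) : x = y := by
  obtain ⟨s, rfl⟩ := Multiset.exists_cons_of_mem hx
  rw [Multiset.filterMap_cons_some f x s hxb, Multiset.nodup_cons] at h
  rcases Multiset.mem_cons.1 hy with rfl | hy
  · rfl
  · exact absurd ((Multiset.mem_filterMap _ _).2 ⟨y, hy, hyb⟩) h.1

/-- Two successful terminal sessions that agree with the same card session are the same, as the card
session has received only one public key. -/
theorem Agrees.unique {m : Mode} {ls : List Label} {F : Subst} {n : ℕ} {P : Proc}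
    {role : ℕ → Role} {L : Multiset Session} (h : Inv m ls F n P role L) {ch ch' t t' a a' p : ℕ}
    (hm : .terminalDone ch t a ∈ L) (hm' : .terminalDone ch' t' a' ∈ L)
    (ha : Agrees m role ls F L ch t a p) (ha' : Agrees m role ls F L ch' t' a' p) : a = a' := by
  obtain ⟨_, _, _, _, _, _, _, _, _, _, _, h1, -, -, _, _, _, _, _, _, h2, -, -, -, -, h3, -⟩ := ha
  obtain ⟨_, _, _, _, _, _, _, _, _, _, _, h4, -, -, _, _, _, _, _, _, h5, -, -, -, -, h6, -⟩ := ha'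
  have hc := eq_of_nodup_filterMap h.nodup_card h1 h4 rfl rfl
  simp only [Session.cardDone.injEq] at hc
  rw [← hc.2.2.2.2.2.1] at h6
  have ht := h3.trans h6.symm
  rw [Term.subst, Term.subst, h2.2.2.2, h5.2.2.2, eqE_iff_nf_eq] at ht
  simp only [nf, mkSmult_g, Term.smult.injEq, Term.var.injEq, and_true] at ht
  subst ht
  have ht := eq_of_nodup_filterMap h.nodup_terminal hm hm' rfl rfl
  simp only [Session.terminalDone.injEq] at ht
  exact ht.2.2

theorem injectiveAgreement (m : Mode) :
    InjectiveAgreement m.ax (system (card m) (terminal m)) := by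
  intro ls B hrun
  by_cases hls : ls = []
  · subst hls
    exact ⟨id, Function.injective_id, fun a chT w _ ha => by simp at ha⟩
  obtain ⟨F, n, P, role, L, hB, h⟩ := exists_inv_of_run hls hrun
  have hsat : ∀ M N, B.Sat m.ax M N ↔ EqE m.ax (M.subst F) (N.subst F) := fun M N => by
    rw [← hB.sat_iff]
    simp only [add_zero, Term.subst_var]
  -- Positions without a successful terminal session are mapped behind the end of the run.
  have hf : ∀ a, ∃ q, (∃ ch t, .terminalDone ch t a ∈ L ∧ Agrees m role ls F L ch t a q ∧
      q < ls.length) ∨ (∀ ch t, .terminalDone ch t a ∉ L) ∧ q = a + ls.length := by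
    intro a
    by_cases ha : ∃ ch t, .terminalDone ch t a ∈ L
    · obtain ⟨ch, t, ha⟩ := ha
      obtain ⟨q, hq⟩ := h.agrees ch t a ha
      refine ⟨q, .inl ⟨ch, t, ha, hq, ?_⟩⟩
      obtain ⟨_, _, _, _, _, _, _, _, _, _, _, -, -, h1, -⟩ := hq
      exact h1.2.1.1.2.2.1.lt
    · push Not at ha
      exact ⟨a + ls.length, .inr ⟨ha, rfl⟩⟩
  choose f hf using hf
  refine ⟨f, fun a a' haa => ?_, fun a chT w _ ha hw => ?_⟩
  · rcases hf a with ⟨ch, t, h1, h2, h3⟩ | ⟨-, h1⟩ <;>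
      rcases hf a' with ⟨ch', t', h4, h5, h6⟩ | ⟨-, h4⟩
    · exact Agrees.unique h h1 h4 h2 (haa ▸ h5)
    · omega
    · omega
    · omega
  · rw [hsat, eqE_iff_nf_eq] at hw
    obtain ⟨_, _, h1⟩ := (h.auth a chT w ha).2 hw
    rcases hf a with ⟨ch, t, h3, h4, -⟩ | ⟨h3, -⟩
    swap
    · exact absurd h1 (h3 _ _)
    generalize f a = p at h4
    obtain ⟨-, -, _, K, hK, hch⟩ := h.ok _ h3
    rw [ha] at hK
    cases hK
    obtain ⟨v, c, ch', b, M, y, i', j', k', u', uk, -, hk,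
      ⟨-, ⟨⟨-, -, c1, c2⟩, -, c3, c4, -⟩, c5, c6, c7, c8, -⟩, i, j, u, k, M₁, M₂,
      ⟨⟨-, -, t1⟩, t2, t3, -⟩, t4, t5, t6, e1, e2, e3⟩ := h4
    have hS : ∀ {i x u K}, EqE m.ax (K.subst F) (.var x) → Sent m ls F i x u →
        SendsAt m.ax ls B i K u := by
      rintro i x u K hK ⟨N, h1, h2⟩
      exact ⟨N, h1, (hsat _ _).2 (h2.trans hK.symm)⟩
    have hR : ∀ {i x N K}, EqE m.ax (K.subst F) (.var x) → Received m ls F i x N →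
        ReceivesAt m.ax ls B i K N := by
      rintro i x N' K hK ⟨N, h1, h2⟩
      exact ⟨N, h1, (hsat _ _).2 (h2.trans hK.symm)⟩
    have hv : EqE m.ax ((Term.var v).subst F) (.var ch') := .of_eq c2
    exact ⟨i, j, k, i', j', k', v, u', u, uk, M₁, M, M₂,
      ⟨t2, t4, t6, hR hch t1, hS hch t3, hR hch t5⟩,
      ⟨c3, c5, c7, hk, hS (.of_eq h.cardName_eq) c1, hS hv c4, hR hv c6, hS hv c8⟩,
      (hsat _ _).2 e1, (hsat _ _).2 e2, (hsat _ _).2 e3⟩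

end EMV

theorem mainTheorem3 :
    (EMV.InjectiveAgreement EMV.E₀ EMV.bdhSystem ∧
      EMV.InjectiveAgreement EMV.E EMV.fixSystem) ∧
    (EMV.InjectiveAgreement EMV.approxE₀ EMV.approxBdhSystem ∧
      EMV.InjectiveAgreement EMV.approxE EMV.approxFixSystem) :=
  ⟨⟨EMV.injectiveAgreement ⟨false, false⟩, EMV.injectiveAgreement ⟨false, true⟩⟩,
    EMV.injectiveAgreement ⟨true, false⟩, EMV.injectiveAgreement ⟨true, true⟩⟩
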